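/- Let $p>3$ be a prime, $k$ an algebraically closed field of characteristic $p$, $W=W(k)$ its ring of Witt vectors with Frobenius $\sigma$, $K=W[1/p]$, $A=W[[t_1,\dots,t_n]]$ and $A_0=A/pA=k[[t_1,\dots,t_n]]$. A lift of Frobenius is a ring endomorphism $\phi$ of $A$ that restricts to $\sigma$ on $W$ and reduces to $x\mapsto x^p$ on $A_0$. An *$F$-crystal* over $A_0$ is a finitely generated free $A$-module $H$ with an integrable, $p$-adically topologically nilpotent connection $\nabla$ (relative to $W$, with $\Omega^1_{A/W}=\bigoplus_j A\,dt_j$) and, for every lift of Frobenius $\phi$, a horizontal $A$-linear map $F(\phi):\phi^*H\to H$ that is an isomorphism after inverting $p$; for two lifts $\phi,\psi$ one requires $F(\psi)\circ\chi(\phi,\psi)=F(\phi)$, where $\chi(\phi,\psi):\phi^*H\to\psi^*H$ is the isomorphism given by the Taylor expansion along $\nabla$. It is a unit $F$-crystal if $F(\phi)$ is an isomorphism. Put $H_0=H/pH$. The Hodge filtration $\mathrm{Fil}^iH_0$ consists of the $x\in H_0$ with a lift $y\in H$ such that $F(\phi)\phi^*y\in p^iH$, and the conjugate filtration $\mathrm{Fil}_iH_0$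 of the $x$ with a lift $y$ such that $p^iy\in\mathrm{Im}\,F(\phi)$; both are independent of $\phi$. An *ordinary CY3 crystal* is an $F$-crystal $H$ over $A_0$ with the following properties and data. - It is of level $3$ ($\mathrm{Fil}_3H_0=H_0$, $\mathrm{Fil}^4H_0=0$) and ordinary: the graded module of $\mathrm{Fil}_\bullet H_0$ is free over $A_0$ and $H_0=\mathrm{Fil}_iH_0\oplus\mathrm{Fil}^{i+1}H_0$ for all $i$. Let $0=U_{-1}\subset U_0\subset U_1\subset\cdots$ be the unique filtration of $H$ by sub-$F$-crystals with $U_i\otimes_AA_0=\mathrm{Fil}_iH_0$ and $U_i/U_{i-1}\simeq V_i(-i)$ with $V_i$ a unit $F$-crystal. - It has a decreasing filtration $\mathrm{Fil}^\bullet H$ by free submodules with $\mathrm{Fil}^0H=H$, $\mathrm{Fil}^iH\otimes_AA_0=\mathrm{Fil}^iH_0$ and $\nabla\,\mathrm{Fil}^iH\subset\Omega^1_{A/W}\otimes\mathrm{Fil}^{i-1}H$, which is divisible: for some $\phi$, $F(\phi)\phi^*\mathrm{Fil}^iH\subset p^iH$ for $0\le i\le3$. - The modules $H^i=U_i\cap\mathrm{Fil}^iH$,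 $i=0,1,2,3$, have ranks $1,h,h,1$. - It has a non-degenerate (perfect) alternating bilinear form $\langle\,,\rangle:H\times H\to A$ with $d\langle x,y\rangle=\langle\nabla x,y\rangle+\langle x,\nabla y\rangle$, with $\langle F(\phi)\phi^*x,F(\phi)\phi^*y\rangle=p^3\phi(\langle x,y\rangle)$ for all lifts $\phi$, and with $(\mathrm{Fil}^3H)^\perp=\mathrm{Fil}^1H$, $(\mathrm{Fil}^2H)^\perp=\mathrm{Fil}^2H$. Let $H$ be an ordinary CY3 crystal over $A_0$ for which the map $\mathrm{Hom}(\Omega^1_{A/W},A)\to\mathrm{Hom}_A(H^3,H^2)$ induced by $\nabla$ is an isomorphism. Let $e_0,\dots,e_{2h+1}$ be a basis of $H$ with $e_0\in H^0$, $e_1,\dots,e_h\in H^1$, $e_{h+1},\dots,e_{2h}\in H^2$, $e_{2h+1}\in H^3$ and with Gram matrix $$\begin{pmatrix}0&0&0&-1\\0&0&I_h&0\\0&-I_h&0&0\\1&0&0&0\end{pmatrix},$$ and let $\mathcal T$ be a matrix over $K[[t_1,\dots,t_n]]$, block upper triangular for the block sizes $1,h,h,1$ with identity blocks on the diagonal,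 such that in this basis $\nabla$ has the matrix $\mathcal T^{-1}d\mathcal T$ and, for every lift of Frobenius $\psi$, $F(\psi)\psi^*$ has the matrix $\mathcal T^{-1}P\,\psi(\mathcal T)$, where $P=\mathrm{diag}(1,pI_h,p^2I_h,p^3)$. Then there are $Z\in K[[t_1,\dots,t_n]]$, columns $\tau_{23}=(\tau_1,\dots,\tau_h)^\star$ and $\tau_{13}$, and an $h\times h$ matrix $\tau_{12}$, with entries in $K[[t_1,\dots,t_n]]$, such that $$\mathcal T=\begin{pmatrix}1&\tau_{23}^\star&0&0\\0&I_h&0&0\\0&0&I_h&\tau_{23}\\0&0&0&1\end{pmatrix}\begin{pmatrix}1&0&-\tau_{13}^\star&Z\\0&I_h&\tau_{12}&\tau_{13}\\0&0&I_h&0\\0&0&0&1\end{pmatrix}$$ (they are determined by $\mathcal T$; $^\star$ is the transpose). Moreover $n=h$, the matrix $(\partial\tau_i/\partial t_j)$ is invertible over $K[[t_1,\dots,t_n]]$, its inverse $G$ has entries in $A$, and, with $\partial/\partial\tau_i=\sum_jG_{ji}\,\partial/\partial t_j$, one has for all $i,j,k\in\{1,\dots,h\}$ $$\Big\langle e_{2h+1},\nabla\Big(\frac{\partial^3}{\partial\tau_i\partial\tau_j\partial\tau_k}\Big)e_{2h+1}\Big\rangle=-\frac12\,\frac{\partial^3Z}{\partial\tau_i\partial\tau_j\partial\tau_k},$$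 where $\nabla\big(\frac{\partial^3}{\partial\tau_i\partial\tau_j\partial\tau_k}\big)=\big(\frac{\partial}{\partial\tau_i}\otimes1\big)\circ\nabla\circ\big(\frac{\partial}{\partial\tau_j}\otimes1\big)\circ\nabla\circ\big(\frac{\partial}{\partial\tau_k}\otimes1\big)\circ\nabla$. -/

import Mathlib

open MvPowerSeries WittVector

namespace CY3Crystal

noncomputable section

/-- The ring `A = W[[t_1, …, t_n]]`, where `W = W(k)` is the ring of `p`-typical Witt vectors. -/
abbrev PowA (p : ℕ) [Fact p.Prime] (k : Type*) [Field k] (n : ℕ) : Type _ :=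
  MvPowerSeries (Fin n) (WittVector p k)

/-- The field `K = W[1/p] = Frac W`. -/
abbrev FracW (p : ℕ) [Fact p.Prime] (k : Type*) [Field k] [CharP k p] : Type _ :=
  FractionRing (WittVector p k)

/-- The ring `K[[t_1, …, t_n]]`. -/
abbrev PowK (p : ℕ) [Fact p.Prime] (k : Type*) [Field k] [CharP k p] (n : ℕ) : Type _ :=
  MvPowerSeries (Fin n) (FracW p k)

/-- The inclusion `W[[t]] → K[[t]]`. -/
def toPowK (p : ℕ) [Fact p.Prime] (k : Type*) [Field k] [CharP k p] (n : ℕ) :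
    PowA p k n →+* PowK p k n :=
  MvPowerSeries.map (algebraMap (WittVector p k) (FracW p k))

/-- The ring `A_0 = A / pA`, which is `k[[t_1, …, t_n]]` when `k` is perfect. -/
abbrev PowA₀ (p : ℕ) [Fact p.Prime] (k : Type*) [Field k] (n : ℕ) : Type _ :=
  PowA p k n ⧸ Ideal.span {(p : PowA p k n)}

/-- A lift of Frobenius: a ring endomorphism of `A` which restricts to the Witt vector Frobenius
on `W` and reduces modulo `p` to the `p`-th power map. -/
structure FrobLift (p : ℕ) [Fact p.Prime] (k : Type*) [Field k] (n : ℕ) where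
  toRingHom : PowA p k n →+* PowA p k n
  map_C : ∀ w : WittVector p k,
    toRingHom (MvPowerSeries.C w) = MvPowerSeries.C (WittVector.frobenius w)
  sub_pow_mem : ∀ a : PowA p k n, toRingHom a - a ^ p ∈ Ideal.span {(p : PowA p k n)}

/-- The divided power `x ^ m / m!`: the element `y` of `A` with `m! y = x ^ m` (it is unique, and
it exists when `x ∈ pA`, the only case in which it is used). -/
def dividedPower {p : ℕ} [Fact p.Prime] {k : Type*} [Field k] {n : ℕ}
    (x : PowA p k n) (m : ℕ) : PowA p k n :=
  Classical.epsilon fun y => (m.factorial : PowA p k n) * y = x ^ m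

/-- The (unordered) sum of the family `u` converges to `s` in the `p`-adic topology of `H`. -/
def PAdicHasSum (p : ℕ) {ι H : Type*} [AddCommGroup H] (u : ι → H) (s : H) : Prop :=
  ∀ r : ℕ, ∃ S₀ : Finset ι, ∀ S : Finset ι, S₀ ⊆ S → ∃ y : H, s - ∑ m ∈ S, u m = p ^ r • y

section Crystals

variable {p : ℕ} [Fact p.Prime] {k : Type*} [Field k] {n : ℕ}

/-- An `F`-crystal over `k[[t_1, …, t_n]]` with underlying `A`-module `H`.

The module of (continuous) differentials `Ω_{A/W}` is free on `dt_1, …, dt_n`, so a connection is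
given by its components `D i = (∂/∂t_i ⊗ 1) ∘ ∇`, i.e. `∇ x = ∑ i, dt_i ⊗ D i x`.
An `A`-linear map `F(φ) : φ^*H → H` is given by the `φ`-semilinear map `Φ φ = F(φ) φ^*`; the image
of `F(φ)` is then the `A`-span of the range of `Φ φ`. -/
structure FCrystal (p : ℕ) [Fact p.Prime] (k : Type*) [Field k] (n : ℕ)
    (H : Type*) [AddCommGroup H] [Module (PowA p k n) H] where
  free : Module.Free (PowA p k n) H
  finite : Module.Finite (PowA p k n) H
  /-- the components of the connection -/
  D : Fin n → AddMonoid.End H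
  leibniz : ∀ (i : Fin n) (a : PowA p k n) (x : H),
    D i (a • x) = pderiv (WittVector p k) i a • x + a • D i x
  integrable : ∀ (i j : Fin n) (x : H), D i (D j x) = D j (D i x)
  /-- `D i ^ m` tends to `0` in the `p`-adic topology of the endomorphism ring -/
  nilpotent : ∀ (i : Fin n) (r : ℕ), ∃ M : ℕ, ∀ m ≥ M, ∀ x : H, ∃ y : H,
    (D i ^ m) x = p ^ r • y
  Φ : ∀ φ : FrobLift p k n, H →ₛₗ[φ.toRingHom] H
  /-- `∇ ∘ Φ = (φ ⊗ Φ) ∘ ∇`, where `φ(dt_j) = dφ(t_j) = ∑ i, ∂φ(t_j)/∂t_i dt_i` -/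
  horizontal : ∀ (φ : FrobLift p k n) (i : Fin n) (x : H),
    D i (Φ φ x) =
      ∑ j, pderiv (WittVector p k) i (φ.toRingHom (MvPowerSeries.X j)) • Φ φ (D j x)
  /-- `F(ψ) ∘ χ(φ, ψ) = F(φ)`, where `χ(φ, ψ)` is given by the Taylor expansion -/
  taylor : ∀ (φ ψ : FrobLift p k n) (x : H),
    PAdicHasSum p
      (fun m : Fin n →₀ ℕ =>
        (∏ j, dividedPower (φ.toRingHom (MvPowerSeries.X j) - ψ.toRingHom (MvPowerSeries.X j))
            (m j)) •
          Φ ψ ((List.ofFn fun j => D j ^ m j).prod x))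
      (Φ φ x)
  /-- `F(φ) ⊗ ℚ` is an isomorphism: it is surjective, which is enough because its source and its
  target are free of the same finite rank over `A[1/p]` -/
  isogeny : ∀ (φ : FrobLift p k n) (x : H), ∃ m : ℕ,
    p ^ m • x ∈ Submodule.span (PowA p k n) (Set.range (Φ φ))

variable {H : Type*} [AddCommGroup H] [Module (PowA p k n) H]

/-- `F(φ)` is an isomorphism for one (equivalently, every) lift of Frobenius `φ` (a surjective
linear map between free modules of the same finite rank is an isomorphism). -/
def FCrystal.IsUnit (X : FCrystal p k n H) : Prop :=
  ∃ φ : FrobLift p k n, Submodule.span (PowA p k n) (Set.range (X.Φ φ)) = ⊤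

/-- `H_0 = H ⊗_A A_0 = H / pH`, a module over `A_0`. -/
abbrev Red (p : ℕ) [Fact p.Prime] (k : Type*) [Field k] (n : ℕ)
    (H : Type*) [AddCommGroup H] [Module (PowA p k n) H] : Type _ :=
  H ⧸ (Ideal.span {(p : PowA p k n)} • ⊤ : Submodule (PowA p k n) H)

/-- The reduction map `H → H_0`. -/
abbrev red (p : ℕ) [Fact p.Prime] (k : Type*) [Field k] (n : ℕ)
    {H : Type*} [AddCommGroup H] [Module (PowA p k n) H] : H →ₗ[PowA p k n] Red p k n H :=
  Submodule.mkQ _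

/-- The conjugate filtration `Fil_i H_0`: the `x` with a lift `y` such that `p^i y ∈ Im F(φ)`. -/
def FCrystal.conjFil (X : FCrystal p k n H) (φ : FrobLift p k n) (i : ℕ) :
    Submodule (PowA₀ p k n) (Red p k n H) where
  carrier := {x | ∃ y : H, red p k n y = x ∧
    p ^ i • y ∈ Submodule.span (PowA p k n) (Set.range (X.Φ φ))}
  zero_mem' := ⟨0, by simp, by simp⟩
  add_mem' := by
    rintro _ _ ⟨y, rfl, hy⟩ ⟨z, rfl, hz⟩
    exact ⟨y + z, by simp, by rw [smul_add]; exact add_mem hy hz⟩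
  smul_mem' := by
    rintro c _ ⟨y, rfl, hy⟩
    obtain ⟨a, rfl⟩ := Ideal.Quotient.mk_surjective c
    refine ⟨a • y, rfl, ?_⟩
    rw [smul_comm]
    exact Submodule.smul_mem _ a hy

/-- The Hodge filtration `Fil^i H_0`: the `x` with a lift `y` such that `F(φ) φ^* y ∈ p^i H`. -/
def FCrystal.hodgeFil₀ (X : FCrystal p k n H) (φ : FrobLift p k n) (i : ℕ) :
    Submodule (PowA₀ p k n) (Red p k n H) where
  carrier := {x | ∃ y : H, red p k n y = x ∧ ∃ z : H, X.Φ φ y = p ^ i • z}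
  zero_mem' := ⟨0, by simp, 0, by simp⟩
  add_mem' := by
    rintro _ _ ⟨y, rfl, u, hu⟩ ⟨z, rfl, v, hv⟩
    exact ⟨y + z, by simp, u + v, by rw [map_add, hu, hv, smul_add]⟩
  smul_mem' := by
    rintro c _ ⟨y, rfl, u, hu⟩
    obtain ⟨a, rfl⟩ := Ideal.Quotient.mk_surjective c
    refine ⟨a • y, rfl, φ.toRingHom a • u, ?_⟩
    rw [LinearMap.map_smulₛₗ, hu, smul_comm]

/-- The term of index `i - 1` of an increasing filtration whose term of index `-1` is `0`. -/
def prevFil {R M : Type*} [Semiring R] [AddCommMonoid M] [Module R M]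
    (U : ℕ → Submodule R M) : ℕ → Submodule R M
  | 0 => ⊥
  | i + 1 => U i

/-- `S ⊗_A A_0 = S_0`: the natural map `S ⊗_A A_0 → H_0` is injective with image `S_0`. -/
def LiftsTo (S : Submodule (PowA p k n) H) (S₀ : Submodule (PowA₀ p k n) (Red p k n H)) : Prop :=
  (∀ x₀ : Red p k n H, x₀ ∈ S₀ ↔ ∃ x ∈ S, red p k n x = x₀) ∧
    ∀ x ∈ S, red p k n x = 0 → ∃ y ∈ S, x = p • y

/-- `Fil` makes the `F`-crystal a Hodge `F`-crystal: a decreasing filtration of `H` by free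
submodules, lifting the Hodge filtration of `H_0`, with Griffiths transversality. -/
structure FCrystal.IsHodge (X : FCrystal p k n H) (Fil : ℕ → Submodule (PowA p k n) H) :
    Prop where
  antitone : Antitone Fil
  zero : Fil 0 = ⊤
  free : ∀ i, Module.Free (PowA p k n) (Fil i)
  lifts : ∃ φ : FrobLift p k n, ∀ i, LiftsTo (Fil i) (X.hodgeFil₀ φ i)
  transversal : ∀ (i : ℕ) (j : Fin n), ∀ x ∈ Fil (i + 1), X.D j x ∈ Fil i

/-- Ordinary `F`-crystals: the graded module of the conjugate filtration is free over `A_0`, and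
the conjugate filtration and the Hodge filtration of `H_0` are opposite.  (The filtrations do not
depend on `φ`.) -/
def FCrystal.IsOrdinary (X : FCrystal p k n H) : Prop :=
  ∃ φ : FrobLift p k n,
    (∀ i, Module.Free (PowA₀ p k n)
      (X.conjFil φ i ⧸ (prevFil (X.conjFil φ) i).submoduleOf (X.conjFil φ i))) ∧
    ∀ i, IsCompl (X.conjFil φ i) (X.hodgeFil₀ φ (i + 1))

/-- `H` is of level `≤ N`. -/
def FCrystal.LevelLE (X : FCrystal p k n H) (N : ℕ) : Prop :=
  ∃ φ : FrobLift p k n, X.conjFil φ N = ⊤ ∧ X.hodgeFil₀ φ (N + 1) = ⊥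

/-- Divisibility of a Hodge `F`-crystal of level `≤ N`. -/
def FCrystal.IsDivisible (X : FCrystal p k n H) (Fil : ℕ → Submodule (PowA p k n) H) (N : ℕ) :
    Prop :=
  ∃ φ : FrobLift p k n, ∀ i ≤ N, ∀ x ∈ Fil i, ∃ y : H, X.Φ φ x = p ^ i • y

/-- `S` is a sub-`F`-crystal: it is an `F`-crystal for the restrictions of `∇` and `F`. -/
def FCrystal.IsSub (X : FCrystal p k n H) (S : Submodule (PowA p k n) H) : Prop :=
  ∃ Y : FCrystal p k n S, (∀ j (x : S), (Y.D j x : H) = X.D j x) ∧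
    ∀ φ (x : S), (Y.Φ φ x : H) = X.Φ φ x

end Crystals

universe u

/-- `U` is the (unique) filtration `0 = U_{-1} ⊆ U_0 ⊆ U_1 ⊆ …` by sub-`F`-crystals which lifts the
conjugate filtration and has `U_i / U_{i-1} ≃ V_i(-i)` with `V_i` a unit `F`-crystal.  The
isomorphism is given as a surjection `U_i → V_i` with kernel `U_{i-1}` that respects `∇` and takes
`F` to `p^i F`, the Frobenius of the Tate twist `V_i(-i)`. -/
structure FCrystal.IsSlopeFiltration {p : ℕ} [Fact p.Prime] {k : Type*} [Field k] {n : ℕ}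
    {H : Type u} [AddCommGroup H] [Module (PowA p k n) H] (X : FCrystal p k n H)
    (U : ℕ → Submodule (PowA p k n) H) : Prop where
  monotone : Monotone U
  sub : ∀ i, X.IsSub (U i)
  lifts : ∃ φ : FrobLift p k n, ∀ i, LiftsTo (U i) (X.conjFil φ i)
  graded : ∀ i, ∃ (V : Type u) (_ : AddCommGroup V) (_ : Module (PowA p k n) V)
    (Y : FCrystal p k n V) (f : U i →ₗ[PowA p k n] V),
    Y.IsUnit ∧ Function.Surjective f ∧ LinearMap.ker f = (prevFil U i).submoduleOf (U i) ∧
    (∀ (j : Fin n) (x y : U i), (y : H) = X.D j x → f y = Y.D j (f x)) ∧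
    ∀ (φ : FrobLift p k n) (x y : U i), (y : H) = X.Φ φ x → f y = p ^ i • Y.Φ φ (f x)

/-- The summand `H^i = U_i ∩ Fil^i H`. -/
abbrev hodgePiece {R M : Type*} [Semiring R] [AddCommMonoid M] [Module R M]
    (U Fil : ℕ → Submodule R M) (i : ℕ) : Submodule R M := U i ⊓ Fil i

/-- An ordinary CY3 crystal: a divisible ordinary Hodge `F`-crystal of level `3` with Hodge numbers
`1, h, h, 1` and a non-degenerate (i.e. perfect) alternating form compatible with `∇` and `F` and
satisfying the Riemann bilinear relations. -/
structure IsOrdinaryCY3 {p : ℕ} [Fact p.Prime] {k : Type*} [Field k] {n : ℕ}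
    {H : Type u} [AddCommGroup H] [Module (PowA p k n) H] (X : FCrystal p k n H)
    (Fil U : ℕ → Submodule (PowA p k n) H) (B : LinearMap.BilinForm (PowA p k n) H) (h : ℕ) :
    Prop where
  hodge : X.IsHodge Fil
  ordinary : X.IsOrdinary
  level : X.LevelLE 3
  divisible : X.IsDivisible Fil 3
  slope : X.IsSlopeFiltration U
  rank_zero : Module.finrank (PowA p k n) (hodgePiece U Fil 0) = 1
  rank_one : Module.finrank (PowA p k n) (hodgePiece U Fil 1) = h
  rank_two : Module.finrank (PowA p k n) (hodgePiece U Fil 2) = h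
  rank_three : Module.finrank (PowA p k n) (hodgePiece U Fil 3) = 1
  alternating : B.IsAlt
  nondegenerate : B.IsPerfPair
  form_connection : ∀ (j : Fin n) (x y : H),
    B (X.D j x) y + B x (X.D j y) = pderiv (WittVector p k) j (B x y)
  form_frobenius : ∀ (φ : FrobLift p k n) (x y : H),
    B (X.Φ φ x) (X.Φ φ y) = (p : PowA p k n) ^ 3 * φ.toRingHom (B x y)
  riemann_three : B.orthogonal (Fil 3) = Fil 1
  riemann_two : B.orthogonal (Fil 2) = Fil 2

/-- The map `T_{A/W} → Hom(H^3, H^2)` induced by `∇` is an isomorphism.  For a vector field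
`θ = ∑ j, a_j ∂/∂t_j`, the image of `θ` is the linear map `f` with `f x ≡ ∇_θ x` modulo `Fil^3`
for all `x ∈ H^3`; so bijectivity says that every `f` comes from exactly one `θ`. -/
def IsKodairaSpencerIso {p : ℕ} [Fact p.Prime] {k : Type*} [Field k] {n : ℕ}
    {H : Type*} [AddCommGroup H] [Module (PowA p k n) H] (X : FCrystal p k n H)
    (Fil U : ℕ → Submodule (PowA p k n) H) : Prop :=
  ∀ f : hodgePiece U Fil 3 →ₗ[PowA p k n] hodgePiece U Fil 2,
    ∃! a : Fin n → PowA p k n, ∀ x : hodgePiece U Fil 3,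
      (f x : H) - ∑ j, a j • X.D j (x : H) ∈ Fil 3

/-! ### Matrices in block form -/

/-- The index set `{0} ⊔ {1, …, h} ⊔ {h + 1, …, 2h} ⊔ {2h + 1}`. -/
abbrev Idx (h : ℕ) : Type := Unit ⊕ Fin h ⊕ Fin h ⊕ Unit

/-- The index `0`. -/
abbrev i0 (h : ℕ) : Idx h := Sum.inl ()

/-- The index `i` (in the second block). -/
abbrev i1 {h : ℕ} (i : Fin h) : Idx h := Sum.inr (Sum.inl i)

/-- The index `h + i` (in the third block). -/
abbrev i2 {h : ℕ} (i : Fin h) : Idx h := Sum.inr (Sum.inr (Sum.inl i))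

/-- The index `2h + 1`. -/
abbrev i3 (h : ℕ) : Idx h := Sum.inr (Sum.inr (Sum.inr ()))

/-- The number (`0`, `1`, `2` or `3`) of the block to which an index belongs. -/
def deg {h : ℕ} : Idx h → ℕ
  | .inl _ => 0
  | .inr (.inl _) => 1
  | .inr (.inr (.inl _)) => 2
  | .inr (.inr (.inr _)) => 3

/-- The Gram matrix `(0,0,0,-1; 0,0,I,0; 0,-I,0,0; 1,0,0,0)`. -/
def gram (R : Type*) [CommRing R] (h : ℕ) : Matrix (Idx h) (Idx h) R
  | .inl _, .inr (.inr (.inr _)) => -1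
  | .inr (.inl i), .inr (.inr (.inl j)) => (1 : Matrix (Fin h) (Fin h) R) i j
  | .inr (.inr (.inl i)), .inr (.inl j) => -(1 : Matrix (Fin h) (Fin h) R) i j
  | .inr (.inr (.inr _)), .inl _ => 1
  | _, _ => 0

/-- Block upper triangular matrices with identity blocks on the diagonal. -/
def IsBlockUnipotent {R : Type*} [CommRing R] {h : ℕ} (T : Matrix (Idx h) (Idx h) R) : Prop :=
  ∀ a b : Idx h, (deg b < deg a → T a b = 0) ∧
    (deg a = deg b → T a b = (1 : Matrix (Idx h) (Idx h) R) a b)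

/-- The matrix `(1, τ₂₃^*, 0, 0; 0, I, 0, 0; 0, 0, I, τ₂₃; 0, 0, 0, 1)`. -/
def leftFactor {R : Type*} [CommRing R] {h : ℕ} (τ₂₃ : Fin h → R) : Matrix (Idx h) (Idx h) R
  | .inl _, .inr (.inl j) => τ₂₃ j
  | .inr (.inr (.inl i)), .inr (.inr (.inr _)) => τ₂₃ i
  | a, b => (1 : Matrix (Idx h) (Idx h) R) a b

/-- The matrix `(1, 0, -τ₁₃^*, Z; 0, I, τ₁₂, τ₁₃; 0, 0, I, 0; 0, 0, 0, 1)`. -/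
def rightFactor {R : Type*} [CommRing R] {h : ℕ} (τ₁₂ : Matrix (Fin h) (Fin h) R)
    (τ₁₃ : Fin h → R) (Z : R) : Matrix (Idx h) (Idx h) R
  | .inl _, .inr (.inr (.inl j)) => -τ₁₃ j
  | .inl _, .inr (.inr (.inr _)) => Z
  | .inr (.inl i), .inr (.inr (.inl j)) => τ₁₂ i j
  | .inr (.inl i), .inr (.inr (.inr _)) => τ₁₃ i
  | a, b => (1 : Matrix (Idx h) (Idx h) R) a b

section Frames

variable {p : ℕ} [Fact p.Prime] {k : Type*} [Field k] [CharP k p] {n : ℕ}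

/-- `g = ψ(f)` for power series `f, g` over `K`: if `f = ∑ a_m t^m` then
`g = ∑ σ(a_m) ψ(t)^m`, where every coefficient is a `p`-adically convergent sum in `K`.
(As `ψ(t_j)` may have a nonzero constant term in `pW`, `ψ(f)` is not defined for all `f`.) -/
def IsFrobImage [PerfectRing k p] (ψ : FrobLift p k n) (f g : PowK p k n) : Prop :=
  ∀ (d : Fin n →₀ ℕ) (r : ℕ), ∃ S₀ : Finset (Fin n →₀ ℕ), ∀ S : Finset (Fin n →₀ ℕ), S₀ ⊆ S →
    ∃ w : WittVector p k,
      MvPowerSeries.coeff d g - ∑ m ∈ S,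
        WittVector.FractionRing.frobeniusRingHom p k (MvPowerSeries.coeff m f) *
          algebraMap (WittVector p k) (FracW p k)
            (MvPowerSeries.coeff d (∏ j, ψ.toRingHom (MvPowerSeries.X j) ^ m j)) =
      (p : FracW p k) ^ r * algebraMap (WittVector p k) (FracW p k) w

variable {H : Type*} [AddCommGroup H] [Module (PowA p k n) H] {h : ℕ}

/-- A basis `e_0, …, e_{2h+1}` of `H` and a matrix `T` over `K[[t]]` such that
* `e_0 ∈ H^0`, `e_1, …, e_h ∈ H^1`, `e_{h+1}, …, e_{2h} ∈ H^2`, `e_{2h+1} ∈ H^3`;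
* the basis has the standard Gram matrix;
* `T` is block upper triangular with identity blocks on the diagonal;
* the matrix of `∇` in the basis is `T⁻¹ dT`;
* for every lift of Frobenius `ψ` the matrix of `F(ψ) ψ^*` in the basis is `T⁻¹ P ψ(T)`, where
  `P = diag(1, p I, p² I, p³)`. -/
structure IsAdaptedFrame [PerfectRing k p] (X : FCrystal p k n H)
    (Fil U : ℕ → Submodule (PowA p k n) H) (B : LinearMap.BilinForm (PowA p k n) H)
    (e : Module.Basis (Idx h) (PowA p k n) H) (T : Matrix (Idx h) (Idx h) (PowK p k n)) :
    Prop where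
  mem : ∀ a, e a ∈ hodgePiece U Fil (deg a)
  gram_eq : ∀ a b, B (e a) (e b) = gram (PowA p k n) h a b
  unipotent : IsBlockUnipotent T
  connection : ∀ (j : Fin n) (a b : Idx h),
    toPowK p k n (e.repr (X.D j (e b)) a) = (T⁻¹ * T.map (pderiv (FracW p k) j)) a b
  frobenius : ∀ ψ : FrobLift p k n, ∃ T' : Matrix (Idx h) (Idx h) (PowK p k n),
    (∀ a b, IsFrobImage ψ (T a b) (T' a b)) ∧
    ∀ a b, toPowK p k n (e.repr (X.Φ ψ (e b)) a) =
      (T⁻¹ * Matrix.diagonal (fun c : Idx h => (p : PowK p k n) ^ deg c) * T') a b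

/-- The Jacobian matrix `(∂τ_i/∂t_j)`. -/
def jacobian (τ : Fin h → PowK p k n) : Matrix (Fin h) (Fin n) (PowK p k n) :=
  Matrix.of fun i j => pderiv (FracW p k) j (τ i)

/-- For `G = (G_{ji})`, the derivation `∑ j, G_{ji} ∂/∂t_j` of `K[[t]]`.  When `G` is the inverse of
the Jacobian matrix of `τ_1, …, τ_h` this is `∂/∂τ_i`. -/
def frameDeriv (G : Matrix (Fin n) (Fin h) (PowA p k n)) (i : Fin h) (f : PowK p k n) :
    PowK p k n :=
  ∑ j, toPowK p k n (G j i) * pderiv (FracW p k) j f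

/-- For `G = (G_{ji})`, the operator `(θ ⊗ 1) ∘ ∇` on `H` with `θ = ∑ j, G_{ji} ∂/∂t_j`. -/
def frameNabla (X : FCrystal p k n H) (G : Matrix (Fin n) (Fin h) (PowA p k n)) (i : Fin h)
    (x : H) : H :=
  ∑ j, G j i • X.D j x

end Frames

end

end CY3Crystal

namespace CY3Crystal

/-! ### Frobenius and valuations on $W$ and $K$. -/

section WittVectors

variable {p : ℕ} [Fact p.Prime] {k : Type*} [Field k] [CharP k p]

/-! Write $\Omega$ for the connection matrix, $g$ for the Gram matrix, so that $d\mathcal T=\mathcal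
T\Omega$. Griffiths transversality and the unipotent shape of $\mathcal T$ leave only the first
block superdiagonal of $\Omega$ (`connMatrix_eq_zero`).

The key fact is that $\mathcal T$ is symplectic (`symplectic`). Since $\nabla$ respects the form,
$d(\mathcal Tg\mathcal T^\star)=0$, and only the constant term $S$ of $\mathcal Tg\mathcal T^\star$
matters. Compatibility of the form with the Frobenius that fixes the origin gives
$p^3S=P\,\sigma(S)\,P$. As $\sigma$ preserves valuations, $S_{ab}=0$ unless the block degrees of $a$
and $b$ add up to $3$, and there unipotency gives $S_{ab}=g_{ab}$ (`constantCoeff_symplectic`).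

The entries of $\mathcal Tg\mathcal T^\star=g$ yield the two factors and the symmetry of $\tau_{12}$
(`IsBlockUnipotent.factorization`). The Jacobian of $\tau_{23}$ is the Kodaira–Spencer matrix, which
is invertible already over $A$ (`exists_ksMatrix_inverse`).

In the coordinates $\tau$, the last column of $d\mathcal T=\mathcal T\Omega$ reads
$\partial_l\mathcal T_{a,2h+1}=\mathcal T_{a,h+l}$. Hence $\partial_l\tau_{13}$ is the $l$-th column
of $\tau_{12}$ and $\partial_lZ=-2(\tau_{13})_l$, so third derivatives of $Z$ are $-2$ times first
derivatives of $\tau_{12}$. Three applications of $\nabla$ carry $e_{2h+1}$ through the blocks down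
to $e_0$, with coefficient $\partial_j(\tau_{12})_{il}$ (`yukawa_eq`). The two sides agree because
$\tau_{12}$ is symmetric and $d(d\tau_{13})=0$. -/

theorem charZero_wittVector : CharZero (WittVector p k) := by
  obtain ⟨q, hq⟩ := CharP.exists (WittVector p k)
  rcases CharP.char_is_prime_or_zero (WittVector p k) q with h | h
  · have h0 : ((q : ℕ) : k) = 0 := by
      have := congrArg (WittVector.constantCoeff : WittVector p k →+* k)
        (CharP.cast_eq_zero (WittVector p k) q)
      simpa only [map_natCast, map_zero] using this
    have hpq : p = q :=
      (Nat.prime_dvd_prime_iff_eq Fact.out h).mp ((CharP.cast_eq_zero_iff k p q).mp h0)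
    subst hpq
    exact absurd (CharP.cast_eq_zero (WittVector p k) p) (WittVector.p_nonzero p k)
  · subst h
    exact CharP.charP_to_charZero _

theorem charZero_fracW : CharZero (FracW p k) :=
  haveI := charZero_wittVector (p := p) (k := k)
  charZero_of_injective_algebraMap (IsFractionRing.injective (WittVector p k) (FracW p k))

variable [PerfectRing k p]

theorem frobeniusRingHom_algebraMap (w : WittVector p k) :
    FractionRing.frobeniusRingHom p k (algebraMap _ (FracW p k) w) =
      algebraMap _ (FracW p k) (WittVector.frobenius w) := by
  simp [FractionRing.frobeniusRingHom, FractionRing.frobenius]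

/-- The Frobenius of `K` preserves the valuation. -/
theorem eq_zero_of_pow_mul_frobenius {i j : ℕ} (hij : i ≠ j) {x : FracW p k}
    (hx : (p : FracW p k) ^ i * x = (p : FracW p k) ^ j * FractionRing.frobeniusRingHom p k x) :
    x = 0 := by
  have hinj := IsFractionRing.injective (WittVector p k) (FracW p k)
  obtain ⟨a, b, hb, rfl⟩ := IsFractionRing.div_surjective (A := WittVector p k) x
  have hb0 : b ≠ 0 := nonZeroDivisors.ne_zero hb
  by_contra hne
  have ha0 : a ≠ 0 := by
    rintro rfl
    simp at hne
  have hfinj := (WittVector.frobenius_bijective p k).injective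
  have hfb0 : WittVector.frobenius b ≠ 0 := by
    rwa [Ne, map_eq_zero_iff _ hfinj]
  have key : (p : WittVector p k) ^ i * (a * WittVector.frobenius b) =
      (p : WittVector p k) ^ j * (b * WittVector.frobenius a) := by
    apply hinj
    have h1 : algebraMap (WittVector p k) (FracW p k) b ≠ 0 := by
      rwa [Ne, map_eq_zero_iff _ hinj]
    have h2 : algebraMap (WittVector p k) (FracW p k) (WittVector.frobenius b) ≠ 0 := by
      rwa [Ne, map_eq_zero_iff _ hinj]
    rw [map_div₀, frobeniusRingHom_algebraMap, frobeniusRingHom_algebraMap] at hx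
    field_simp at hx
    simp only [map_mul, map_pow, map_natCast]
    linear_combination hx
  obtain ⟨s, u, rfl⟩ := WittVector.exists_eq_pow_p_mul' a ha0
  obtain ⟨t, v, rfl⟩ := WittVector.exists_eq_pow_p_mul' b hb0
  have hp0 := WittVector.p_nonzero p k
  -- $\sigma$ fixes $p$, so the same power $p^{s+t}$ splits off on both sides and only units remain
  -- next to $p^i$ and $p^j$.
  have key2 : (p : WittVector p k) ^ i *
        ((u : WittVector p k) * WittVector.frobenius (v : WittVector p k)) =
      (p : WittVector p k) ^ j *
        ((v : WittVector p k) * WittVector.frobenius (u : WittVector p k)) := by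
    simp only [map_mul, map_pow, map_natCast] at key
    apply mul_left_cancel₀ (pow_ne_zero (s + t) hp0)
    linear_combination key
  have hu : ∀ x y : (WittVector p k)ˣ, IsUnit ((x : WittVector p k) * WittVector.frobenius (y : WittVector p k)) :=
    fun x y => x.isUnit.mul (y.isUnit.map _)
  have hirr := WittVector.irreducible p (k := k)
  have aux : ∀ (i j : ℕ) (x y : WittVector p k), IsUnit y →
      (p : WittVector p k) ^ i * x = (p : WittVector p k) ^ j * y → ¬ j < i := by
    intro i j x y hy h hlt
    obtain ⟨d, rfl⟩ := Nat.exists_eq_add_of_lt hlt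
    have : y = p * ((p : WittVector p k) ^ d * x) := by
      apply mul_left_cancel₀ (pow_ne_zero j hp0)
      rw [← h]
      ring
    exact hirr.not_isUnit (isUnit_of_dvd_unit ⟨_, this⟩ hy)
  rcases lt_or_gt_of_ne hij with h | h
  · exact aux _ _ _ _ (hu u v) key2.symm h
  · exact aux _ _ _ _ (hu v u) key2 h

/-- $p$-adic separatedness of $K$. It turns the congruences modulo every $p^r$ that define
`IsFrobImage` into equalities. -/
theorem eq_zero_of_forall_pow_mul {x : FracW p k}
    (hx : ∀ r : ℕ, ∃ w : WittVector p k, x = (p : FracW p k) ^ r * algebraMap _ _ w) : x = 0 := by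
  have hinj := IsFractionRing.injective (WittVector p k) (FracW p k)
  obtain ⟨a, b, hb, rfl⟩ := IsFractionRing.div_surjective (A := WittVector p k) x
  have hb0 : algebraMap (WittVector p k) (FracW p k) b ≠ 0 := by
    rw [Ne, map_eq_zero_iff _ hinj]
    exact nonZeroDivisors.ne_zero hb
  have ha : a = 0 := by
    -- The exponent $r+1$ is what kills the Witt component of index $r$.
    ext r
    obtain ⟨w, hw⟩ := hx (r + 1)
    have : a = (p : WittVector p k) ^ (r + 1) * (w * b) := by
      apply hinj
      rw [div_eq_iff hb0] at hw
      rw [hw]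
      simp only [map_mul, map_pow, map_natCast]
      ring
    have hmem : a ∈ Ideal.span {(p ^ (r + 1) : WittVector p k)} :=
      Ideal.mem_span_singleton.mpr ⟨_, this⟩
    rw [WittVector.mem_span_p_pow_iff_le_coeff_eq_zero] at hmem
    simpa using hmem r (Nat.lt_succ_self r)
  simp [ha]

end WittVectors

/-! ### The Frobenius lift that fixes the origin. -/

section FrobeniusLift

variable (p : ℕ) [Fact p.Prime] (k : Type*) [Field k] [CharP k p] [PerfectRing k p] (n : ℕ)

/-- The lift of Frobenius with `t_j ↦ t_j ^ p`. -/
noncomputable def stdFrobLift : FrobLift p k n where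
  toRingHom := ((MvPowerSeries.expand p (Fact.out : p.Prime).ne_zero).toRingHom).comp
    (MvPowerSeries.map (WittVector.frobenius : WittVector p k →+* WittVector p k))
  map_C w := by
    simp [MvPowerSeries.expand_C]
  sub_pow_mem a := by
    have hp : p ≠ 0 := (Fact.out : p.Prime).ne_zero
    set b := ((MvPowerSeries.expand p hp).toRingHom).comp
      (MvPowerSeries.map (WittVector.frobenius : WittVector p k →+* WittVector p k)) a - a ^ p
      with hb
    have hcomp : (WittVector.constantCoeff : WittVector p k →+* k).comp WittVector.frobenius =
        (_root_.frobenius k p).comp WittVector.constantCoeff := by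
      ext w
      simp [WittVector.coeff_frobenius_charP, _root_.frobenius_def]
    -- Over $k$, raising the coefficients to the $p$-th power and substituting $t_j^p$ for $t_j$ is
    -- the $p$-th power map.
    have h0 : MvPowerSeries.map (WittVector.constantCoeff : WittVector p k →+* k) b = 0 := by
      rw [hb, map_sub, map_pow, sub_eq_zero, ← MvPowerSeries.map_frobenius_expand p hp]
      simp only [AlgHom.toRingHom_eq_coe, RingHom.coe_comp, RingHom.coe_coe, Function.comp_apply,
        MvPowerSeries.map_expand, MvPowerSeries.map_map, hcomp]
    have hc : ∀ d, ∃ c : WittVector p k, MvPowerSeries.coeff d b = p * c := by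
      intro d
      have := congrArg (MvPowerSeries.coeff d) h0
      rw [MvPowerSeries.coeff_map, map_zero] at this
      have hmem : MvPowerSeries.coeff d b ∈ Ideal.span {(p : WittVector p k)} := by
        rwa [WittVector.mem_span_p_iff_coeff_zero_eq_zero]
      exact Ideal.mem_span_singleton.mp hmem
    choose c hc using hc
    rw [Ideal.mem_span_singleton]
    let q : PowA p k n := fun d => c d
    have hq : ∀ d, MvPowerSeries.coeff d q = c d := fun _ => rfl
    refine ⟨q, ?_⟩
    ext1 d
    rw [hc, ← map_natCast (MvPowerSeries.C (σ := Fin n) (R := WittVector p k)),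
      MvPowerSeries.coeff_C_mul, hq]

theorem stdFrobLift_X (j : Fin n) :
    (stdFrobLift p k n).toRingHom (MvPowerSeries.X j) = MvPowerSeries.X j ^ p := by
  simp [stdFrobLift]

variable {p k n}

/-- Since $t_j\mapsto t_j^p$ preserves the origin, every monomial $\psi(t)^m$ with $m\ne0$ has
constant term $0$, and only $\sigma(a_0)$ contributes. -/
theorem IsFrobImage.constantCoeff_eq {f g : PowK p k n}
    (hfg : IsFrobImage (stdFrobLift p k n) f g) :
    MvPowerSeries.constantCoeff g =
      FractionRing.frobeniusRingHom p k (MvPowerSeries.constantCoeff f) := by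
  rw [← sub_eq_zero]
  apply eq_zero_of_forall_pow_mul
  intro r
  obtain ⟨S₀, hS₀⟩ := hfg 0 r
  -- The index $0$ is adjoined so that the one surviving term occurs in the partial sum.
  obtain ⟨w, hw⟩ := hS₀ (insert 0 S₀) (Finset.subset_insert _ _)
  refine ⟨w, ?_⟩
  rw [← hw, MvPowerSeries.coeff_zero_eq_constantCoeff, Finset.sum_eq_single 0]
  · simp
  · intro m _ hm
    obtain ⟨j, hj⟩ := Finsupp.ne_iff.mp hm
    have : MvPowerSeries.constantCoeff
        (∏ j, (stdFrobLift p k n).toRingHom (MvPowerSeries.X j) ^ m j) = 0 := by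
      rw [map_prod]
      apply Finset.prod_eq_zero (Finset.mem_univ j)
      rw [stdFrobLift_X, map_pow, map_pow, MvPowerSeries.constantCoeff_X,
        zero_pow (Fact.out : p.Prime).ne_zero, zero_pow hj]
    rw [MvPowerSeries.coeff_zero_eq_constantCoeff_apply, this, map_zero, mul_zero]
  · intro h
    simp at h

end FrobeniusLift

/-! ### Block unipotent matrices and the Gram matrix. -/

section BlockMatrices

theorem IsBlockUnipotent.isUnit_det {R : Type*} [CommRing R] {h : ℕ}
    {T : Matrix (Idx h) (Idx h) R} (hT : IsBlockUnipotent T) : IsUnit T.det := by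
  have hbt : T.BlockTriangular deg := fun a b hab => (hT a b).1 hab
  rw [hbt.det]
  have : ∀ c ∈ Finset.univ.image (deg (h := h)), (T.toSquareBlock deg c).det = 1 := by
    intro c _
    rw [← Matrix.det_one (n := { a : Idx h // deg a = c })]
    congr 1
    ext a b
    rw [Matrix.toSquareBlock_def, Matrix.of_apply, (hT a b).2 (a.2.trans b.2.symm),
      Matrix.one_apply, Matrix.one_apply]
    simp [Subtype.ext_iff]
  rw [Finset.prod_eq_one this]
  exact isUnit_one

theorem gram_mul_gram (R : Type*) [CommRing R] (h : ℕ) : gram R h * gram R h = -1 := by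
  ext a b
  rcases a with _ | a | a | _ <;> rcases b with _ | b | b | _ <;>
    simp [Matrix.mul_apply, gram, Fintype.sum_sum_type, Matrix.one_apply]

theorem gram_map {R S : Type*} [CommRing R] [CommRing S] (f : R →+* S) (h : ℕ) :
    (gram R h).map f = gram S h := by
  ext a b
  rcases a with _ | a | a | _ <;> rcases b with _ | b | b | _ <;>
    simp [gram, Matrix.one_apply, apply_ite f]

theorem gram_eq_zero {R : Type*} [CommRing R] {h : ℕ} {a b : Idx h} (hab : deg a + deg b ≠ 3) :
    gram R h a b = 0 := by
  rcases a with _ | a | a | _ <;> rcases b with _ | b | b | _ <;> simp_all [gram, deg]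

/-- A nonzero term $T_{ac}\,g_{cd}\,T_{bd}$ needs $\deg c\ge\deg a$, $\deg d\ge\deg b$ and $\deg
c+\deg d=3$. On the antidiagonal this forces equality, so only the identity blocks of $T$ enter. -/
theorem IsBlockUnipotent.mul_gram_mul_transpose_apply {R : Type*} [CommRing R] {h : ℕ}
    {T : Matrix (Idx h) (Idx h) R} (hT : IsBlockUnipotent T) {a b : Idx h}
    (hab : deg a + deg b = 3) : (T * gram R h * T.transpose) a b = gram R h a b := by
  simp only [Matrix.mul_apply, Matrix.transpose_apply]
  have h1 : ∀ c d, T a c * gram R h c d * T b d =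
      (1 : Matrix (Idx h) (Idx h) R) a c * gram R h c d * (1 : Matrix (Idx h) (Idx h) R) b d := by
    intro c d
    by_cases hcd : deg c + deg d = 3
    · rcases lt_trichotomy (deg a) (deg c) with hac | hac | hac
      · have hdb : deg d < deg b := by omega
        have : b ≠ d := by rintro rfl; exact lt_irrefl _ hdb
        rw [(hT b d).1 hdb, Matrix.one_apply_ne this]
        simp
      · rw [(hT a c).2 hac, (hT b d).2 (by omega)]
      · have : a ≠ c := by rintro rfl; exact lt_irrefl _ hac
        rw [(hT a c).1 hac, Matrix.one_apply_ne this]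
        simp
    · rw [gram_eq_zero hcd]
      simp
  simp only [Finset.sum_mul, h1]
  simp [Matrix.one_apply]

end BlockMatrices

/-! ### The connection matrix in an adapted basis. -/

theorem deg_le_three {h : ℕ} (a : Idx h) : deg a ≤ 3 := by
  rcases a with _ | a | a | _ <;> simp [deg]

theorem pderiv_comm {σ R : Type*} [CommRing R] (i j : σ) (f : MvPowerSeries σ R) :
    pderiv R i (pderiv R j f) = pderiv R j (pderiv R i f) := by
  classical
  ext d
  simp only [coeff_pderiv, Finsupp.add_apply, add_right_comm d (Finsupp.single i 1)]
  by_cases hij : i = j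
  · subst hij
    rfl
  · rw [Finsupp.single_eq_of_ne hij, Finsupp.single_eq_of_ne (Ne.symm hij)]
    push_cast
    ring

section

variable {p : ℕ} [Fact p.Prime] {k : Type*} [Field k] [CharP k p] {n : ℕ}

theorem toPowK_injective : Function.Injective (toPowK p k n) := by
  intro f g hfg
  ext1 d
  have := congrArg (MvPowerSeries.coeff d) hfg
  simp only [toPowK, MvPowerSeries.coeff_map] at this
  exact IsFractionRing.injective (WittVector p k) (FracW p k) this

theorem constantCoeff_toPowK (f : PowA p k n) :
    MvPowerSeries.constantCoeff (toPowK p k n f) = algebraMap _ _ (MvPowerSeries.constantCoeff f) :=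
  MvPowerSeries.constantCoeff_map _ _

variable {H : Type*} [AddCommGroup H] [Module (PowA p k n) H] {h : ℕ}

/-- The matrix of the component `∇_j` of the connection in a basis. -/
noncomputable def connMatrix (X : FCrystal p k n H) (e : Module.Basis (Idx h) (PowA p k n) H) (j : Fin n) :
    Matrix (Idx h) (Idx h) (PowA p k n) :=
  Matrix.of fun a b => e.repr (X.D j (e b)) a

omit [CharP k p] in
theorem repr_D (X : FCrystal p k n H) (e : Module.Basis (Idx h) (PowA p k n) H) (j : Fin n) (x : H)
    (a : Idx h) :
    e.repr (X.D j x) a =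
      pderiv (WittVector p k) j (e.repr x a) + ∑ b, connMatrix X e j a b * e.repr x b := by
  classical
  conv_lhs => rw [← e.sum_repr x]
  simp only [map_sum, X.leibniz, map_add, map_smul, Finsupp.coe_finsetSum, Finset.sum_apply,
    Finsupp.coe_add, Pi.add_apply, Finsupp.coe_smul, Pi.smul_apply, smul_eq_mul,
    Finset.sum_add_distrib]
  have h1 : ∑ b, pderiv (WittVector p k) j (e.repr x b) * e.repr (e b) a =
      pderiv (WittVector p k) j (e.repr x a) := by
    rw [Finset.sum_eq_single a]
    · rw [e.repr_self, Finsupp.single_eq_same, mul_one]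
    · intro b _ hb
      rw [e.repr_self, Finsupp.single_eq_of_ne (Ne.symm hb), mul_zero]
    · exact fun ha => absurd (Finset.mem_univ a) ha
  rw [h1]
  exact congrArg _ (Finset.sum_congr rfl fun b _ => mul_comm _ _)

omit [CharP k p] in
theorem repr_frameNabla (X : FCrystal p k n H) (e : Module.Basis (Idx h) (PowA p k n) H)
    (G : Matrix (Fin n) (Fin h) (PowA p k n)) (i : Fin h) (x : H) (a : Idx h) :
    e.repr (frameNabla X G i x) a = ∑ j, G j i * (pderiv (WittVector p k) j (e.repr x a) +
      ∑ b, connMatrix X e j a b * e.repr x b) := by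
  simp only [frameNabla, map_sum, map_smul, Finsupp.coe_finsetSum, Finset.sum_apply,
    Finsupp.coe_smul, Pi.smul_apply, smul_eq_mul, repr_D]

variable [PerfectRing k p] {X : FCrystal p k n H} {Fil U : ℕ → Submodule (PowA p k n) H}
  {B : LinearMap.BilinForm (PowA p k n) H} {e : Module.Basis (Idx h) (PowA p k n) H}
  {T : Matrix (Idx h) (Idx h) (PowK p k n)}

namespace IsAdaptedFrame

theorem form_apply (hT : IsAdaptedFrame X Fil U B e T) (x y : H) :
    B x y = ∑ a, ∑ b, e.repr x a * gram (PowA p k n) h a b * e.repr y b := by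
  conv_lhs => rw [← e.sum_repr x, ← e.sum_repr y]
  simp only [map_sum, LinearMap.sum_apply, map_smul, LinearMap.smul_apply, hT.gram_eq, smul_eq_mul]
  rw [Finset.sum_comm]
  refine Finset.sum_congr rfl fun a _ => ?_
  rw [Finset.mul_sum]
  exact Finset.sum_congr rfl fun b _ => by ring

theorem form_basis_left (hT : IsAdaptedFrame X Fil U B e T) (a : Idx h) (y : H) :
    B (e a) y = ∑ b, gram (PowA p k n) h a b * e.repr y b := by
  rw [hT.form_apply]
  simp [Finsupp.single_apply]

theorem basis_mem_fil (hT : IsAdaptedFrame X Fil U B e T) (a : Idx h) : e a ∈ Fil (deg a) :=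
  (hT.mem a).2

/-- The Hodge filtration is spanned by basis vectors. -/
theorem repr_eq_zero_of_mem_fil (hT : IsAdaptedFrame X Fil U B e T)
    (hX : IsOrdinaryCY3 X Fil U B h) {a : Idx h} {i : ℕ} (hi : deg a < i) (hi3 : i ≤ 3)
    {x : H} (hx : x ∈ Fil i) : e.repr x a = 0 := by
  have hanti := hX.hodge.antitone
  -- Up to sign, a coordinate is the pairing with the dual basis vector, which lies in block $3-\deg
  -- a$. The Riemann relations make this pairing vanish on $\mathrm{Fil}^i$.
  have horth : ∀ b y, y ∈ B.orthogonal (Fil (deg b)) → B (e b) y = 0 := fun b y hy =>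
    hy _ (hT.basis_mem_fil b)
  rcases a with ⟨⟩ | a | a | ⟨⟩
  · have := horth (i3 h) x (by
      show x ∈ B.orthogonal (Fil 3)
      rw [hX.riemann_three]
      exact hanti hi hx)
    rw [hT.form_basis_left] at this
    simpa [gram, Fintype.sum_sum_type] using this
  · have := horth (i2 a) x (by
      show x ∈ B.orthogonal (Fil 2)
      rw [hX.riemann_two]
      exact hanti hi hx)
    rw [hT.form_basis_left] at this
    simpa [gram, Fintype.sum_sum_type, Matrix.one_apply] using this
  · have hx3 : x ∈ Fil 3 := hanti hi hx
    have h1 : e (i1 a) ∈ B.orthogonal (Fil 3) := by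
      rw [hX.riemann_three]
      exact hT.basis_mem_fil (i1 a)
    have : B (e (i1 a)) x = 0 := by
      rw [← neg_eq_zero, hX.alternating.neg_eq]
      exact h1 x hx3
    rw [hT.form_basis_left] at this
    simpa [gram, Fintype.sum_sum_type, Matrix.one_apply] using this
  · exact absurd (hi.trans_le hi3) (lt_irrefl 3)

theorem map_pderiv_eq (hT : IsAdaptedFrame X Fil U B e T) (j : Fin n) :
    T.map (pderiv (FracW p k) j) = T * (connMatrix X e j).map (toPowK p k n) := by
  have : (connMatrix X e j).map (toPowK p k n) = T⁻¹ * T.map (pderiv (FracW p k) j) := by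
    ext1 a b
    rw [← hT.connection]
    rfl
  rw [this, ← mul_assoc, Matrix.mul_nonsing_inv _ hT.unipotent.isUnit_det, one_mul]

/-- Griffiths transversality, and horizontality of the slope filtration. -/
theorem connMatrix_eq_zero (hT : IsAdaptedFrame X Fil U B e T) (hX : IsOrdinaryCY3 X Fil U B h)
    (j : Fin n) {a b : Idx h} (hab : deg a + 1 ≠ deg b) : connMatrix X e j a b = 0 := by
  rcases lt_or_gt_of_ne hab with hlt | hgt
  · obtain ⟨c, hc⟩ : ∃ c, deg b = c + 1 := ⟨deg b - 1, by omega⟩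
    refine hT.repr_eq_zero_of_mem_fil hX (i := c) (by omega) ?_ (hX.hodge.transversal c j _ ?_)
    · have := deg_le_three b
      omega
    · rw [← hc]
      exact hT.basis_mem_fil b
  -- Here $\deg b\le\deg a$. The entry of $T^{-1}dT$ vanishes because $T^{-1}$ is block upper
  -- triangular, while $dT$ is strictly so, the diagonal blocks of $T$ being constant.
  · apply toPowK_injective
    rw [map_zero]
    have hcon := hT.connection j a b
    rw [Matrix.mul_apply] at hcon
    refine hcon.trans (Finset.sum_eq_zero fun c _ => ?_)
    have hdet := hT.unipotent.isUnit_det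
    let _ := Matrix.invertibleOfIsUnitDet T hdet
    have hbt : T.BlockTriangular deg := fun a b hab => (hT.unipotent a b).1 hab
    have hinv := Matrix.blockTriangular_inv_of_blockTriangular hbt
    by_cases hac : deg c < deg a
    · rw [hinv hac, zero_mul]
    · rw [Matrix.map_apply]
      rcases lt_or_eq_of_le (show deg b ≤ deg c by omega) with hbc | hbc
      · rw [(hT.unipotent c b).1 hbc, map_zero, mul_zero]
      · rw [(hT.unipotent c b).2 hbc.symm, Matrix.one_apply]
        split_ifs <;> simp

theorem connMatrix_symplectic (hT : IsAdaptedFrame X Fil U B e T) (hX : IsOrdinaryCY3 X Fil U B h)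
    (j : Fin n) :
    (connMatrix X e j).transpose * gram _ h + gram _ h * connMatrix X e j = 0 := by
  ext1 a b
  have hg := hX.form_connection j (e a) (e b)
  have hc : pderiv (WittVector p k) j (gram (PowA p k n) h a b) = 0 := by
    have : gram (PowA p k n) h a b = MvPowerSeries.C (gram (WittVector p k) h a b) := by
      rw [← gram_map (MvPowerSeries.C (σ := Fin n) (R := WittVector p k))]
      rfl
    rw [this, pderiv_C]
  rw [hT.gram_eq, hc, hT.form_basis_left, hT.form_apply] at hg
  rw [Matrix.zero_apply, ← hg]
  simp [Matrix.mul_apply, Finsupp.single_apply, connMatrix]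

/-- Conjugate form of the infinitesimal symplectic relation, obtained by multiplying with $g$ on
both sides and using $g^2=-1$. It is the form that occurs in the derivative of $TgT^\star$. -/
theorem connMatrix_symplectic' (hT : IsAdaptedFrame X Fil U B e T)
    (hX : IsOrdinaryCY3 X Fil U B h) (j : Fin n) :
    connMatrix X e j * gram _ h + gram _ h * (connMatrix X e j).transpose = 0 := by
  have h1 := hT.connMatrix_symplectic hX j
  have h2 := gram_mul_gram (PowA p k n) h
  set g := gram (PowA p k n) h
  set Ω := connMatrix X e j
  calc Ω * g + g * Ω.transpose
      = -(g * (Ω.transpose * g + g * Ω) * g) := by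
        have e1 : g * (Ω.transpose * g + g * Ω) * g =
          g * Ω.transpose * (g * g) + (g * g) * Ω * g := by noncomm_ring
        rw [e1, h2]
        noncomm_ring
    _ = 0 := by rw [h1]; simp

end IsAdaptedFrame
end
-- The matrix $\mathcal T$ is symplectic.
theorem map_derivation_mul {R A ι : Type*} [CommRing R] [CommRing A] [Algebra R A] [Fintype ι]
    (d : Derivation R A A) (M N : Matrix ι ι A) :
    (M * N).map d = M.map d * N + M * N.map d := by
  ext1 a b
  simp only [Matrix.map_apply, Matrix.mul_apply, Matrix.add_apply, map_sum, Derivation.leibniz,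
    smul_eq_mul, ← Finset.sum_add_distrib]
  exact Finset.sum_congr rfl fun c _ => by ring

theorem gram_eq_map_C (σ R : Type*) [CommRing R] (h : ℕ) :
    gram (MvPowerSeries σ R) h = (gram R h).map MvPowerSeries.C :=
  (gram_map (MvPowerSeries.C (σ := σ) (R := R)) h).symm

/-- As $g^2=-1$, the hypothesis exhibits $-c^{-1}gM^\star g$ as a left inverse of $M$. It is then a
right inverse too, which is the transposed relation. -/
theorem symplectic_transpose {K : Type*} [Field K] {h : ℕ} {c : K} (hc : c ≠ 0)
    {M : Matrix (Idx h) (Idx h) K} (hM : M.transpose * gram K h * M = c • gram K h) :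
    M * gram K h * M.transpose = c • gram K h := by
  have hg := gram_mul_gram K h
  set g := gram K h
  have h1 : (c⁻¹ • -(g * M.transpose * g)) * M = 1 := by
    calc (c⁻¹ • -(g * M.transpose * g)) * M = c⁻¹ • -(g * (M.transpose * g * M)) := by
          simp only [Matrix.smul_mul, Matrix.neg_mul, Matrix.mul_assoc]
      _ = 1 := by
          rw [hM, Matrix.mul_smul, hg, smul_neg, smul_neg, smul_neg, neg_neg, smul_smul,
            inv_mul_cancel₀ hc, one_smul]
  have h2 := mul_eq_one_comm.mp h1
  have h3 : c • 1 = c • (M * (c⁻¹ • -(g * M.transpose * g))) := by rw [h2]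
  rw [Matrix.mul_smul, smul_smul, mul_inv_cancel₀ hc, one_smul] at h3
  calc M * g * M.transpose = M * -(g * M.transpose * g) * g := by
        rw [Matrix.mul_neg, Matrix.neg_mul, ← mul_assoc, ← mul_assoc, mul_assoc _ g g, hg,
          mul_neg, neg_neg, mul_one]
    _ = c • g := by rw [← h3, Matrix.smul_mul, one_mul]

section

variable {p : ℕ} [Fact p.Prime] {k : Type*} [Field k] [CharP k p] [PerfectRing k p] {n : ℕ}
  {H : Type*} [AddCommGroup H] [Module (PowA p k n) H] {h : ℕ}
  {X : FCrystal p k n H} {Fil U : ℕ → Submodule (PowA p k n) H}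
  {B : LinearMap.BilinForm (PowA p k n) H} {e : Module.Basis (Idx h) (PowA p k n) H}
  {T : Matrix (Idx h) (Idx h) (PowK p k n)}

/-- The matrix of `F(φ) φ^*` in a basis. -/
noncomputable def frobMatrix (X : FCrystal p k n H) (e : Module.Basis (Idx h) (PowA p k n) H)
    (φ : FrobLift p k n) : Matrix (Idx h) (Idx h) (PowA p k n) :=
  Matrix.of fun a b => e.repr (X.Φ φ (e b)) a

namespace IsAdaptedFrame

theorem frobMatrix_symplectic (hT : IsAdaptedFrame X Fil U B e T) (hX : IsOrdinaryCY3 X Fil U B h)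
    (φ : FrobLift p k n) :
    (frobMatrix X e φ).transpose * gram _ h * frobMatrix X e φ =
      (p : PowA p k n) ^ 3 • gram _ h := by
  ext1 a b
  have hF := hX.form_frobenius φ (e a) (e b)
  have hg : φ.toRingHom (gram (PowA p k n) h a b) = gram (PowA p k n) h a b :=
    congrFun (congrFun (gram_map φ.toRingHom h) a) b
  rw [hT.gram_eq, hg, hT.form_apply, Finset.sum_comm] at hF
  rw [Matrix.smul_apply, smul_eq_mul, ← hF]
  simp only [Matrix.mul_apply, Matrix.transpose_apply, Finset.sum_mul]
  rfl

/-- The constant term of `T` intertwines the constant term of the Frobenius with `P`. -/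
theorem constantCoeff_frobenius (hT : IsAdaptedFrame X Fil U B e T) :
    T.map MvPowerSeries.constantCoeff *
        (frobMatrix X e (stdFrobLift p k n)).map
          ((algebraMap (WittVector p k) (FracW p k)).comp MvPowerSeries.constantCoeff) =
      Matrix.diagonal (fun c : Idx h => (p : FracW p k) ^ deg c) *
        (T.map MvPowerSeries.constantCoeff).map (FractionRing.frobeniusRingHom p k) := by
  obtain ⟨T', hT', hΦ⟩ := hT.frobenius (stdFrobLift p k n)
  have h1 : (frobMatrix X e (stdFrobLift p k n)).map (toPowK p k n) =
      T⁻¹ * Matrix.diagonal (fun c : Idx h => (p : PowK p k n) ^ deg c) * T' := by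
    ext1 a b
    exact hΦ a b
  have h2 : T * (frobMatrix X e (stdFrobLift p k n)).map (toPowK p k n) =
      Matrix.diagonal (fun c : Idx h => (p : PowK p k n) ^ deg c) * T' := by
    rw [h1, ← mul_assoc, ← mul_assoc, Matrix.mul_nonsing_inv _ hT.unipotent.isUnit_det, one_mul]
  have h3 := congrArg
    (fun M : Matrix (Idx h) (Idx h) (PowK p k n) =>
      M.map (MvPowerSeries.constantCoeff : PowK p k n →+* FracW p k)) h2
  simp only [Matrix.map_mul] at h3
  have h4 : T'.map (MvPowerSeries.constantCoeff : PowK p k n →+* FracW p k) =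
      (T.map MvPowerSeries.constantCoeff).map (FractionRing.frobeniusRingHom p k) := by
    ext1 a b
    exact (hT' a b).constantCoeff_eq
  have h5 : ((frobMatrix X e (stdFrobLift p k n)).map (toPowK p k n)).map
        (MvPowerSeries.constantCoeff : PowK p k n →+* FracW p k) =
      (frobMatrix X e (stdFrobLift p k n)).map
          ((algebraMap (WittVector p k) (FracW p k)).comp MvPowerSeries.constantCoeff) := by
    ext1 a b
    exact constantCoeff_toPowK _
  rw [h4, h5, Matrix.diagonal_map (map_zero _)] at h3
  simpa only [map_pow, map_natCast] using h3

/-- The flat frame is symplectic at the origin, by comparison of the slopes of Frobenius. -/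
theorem constantCoeff_symplectic (hT : IsAdaptedFrame X Fil U B e T)
    (hX : IsOrdinaryCY3 X Fil U B h) :
    T.map MvPowerSeries.constantCoeff * gram (FracW p k) h *
      (T.map MvPowerSeries.constantCoeff).transpose = gram (FracW p k) h := by
  have := charZero_fracW (p := p) (k := k)
  have hp0 : (p : FracW p k) ≠ 0 := Nat.cast_ne_zero.mpr (Fact.out : p.Prime).ne_zero
  have hF := hT.constantCoeff_frobenius
  have hS := congrArg (fun M : Matrix (Idx h) (Idx h) (PowA p k n) => M.map
    ((algebraMap (WittVector p k) (FracW p k)).comp MvPowerSeries.constantCoeff))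
    (hT.frobMatrix_symplectic hX (stdFrobLift p k n))
  set σ := FractionRing.frobeniusRingHom p k
  set ι : PowA p k n →+* FracW p k :=
    (algebraMap (WittVector p k) (FracW p k)).comp MvPowerSeries.constantCoeff
  set T₀ := T.map (MvPowerSeries.constantCoeff : PowK p k n →+* FracW p k) with hT₀
  set Φ := (frobMatrix X e (stdFrobLift p k n)).map ι with hΦ
  set D := Matrix.diagonal (fun c : Idx h => (p : FracW p k) ^ deg c) with hD
  have hu : IsBlockUnipotent T₀ := by
    intro a b
    refine ⟨fun hab => ?_, fun hab => ?_⟩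
    · rw [hT₀, Matrix.map_apply, (hT.unipotent a b).1 hab, map_zero]
    · rw [hT₀, Matrix.map_apply, (hT.unipotent a b).2 hab, Matrix.one_apply, Matrix.one_apply]
      split_ifs <;> simp
  have hS' : Φ.transpose * gram (FracW p k) h * Φ = (p : FracW p k) ^ 3 • gram (FracW p k) h := by
    have e1 : ((p : PowA p k n) ^ 3 • gram (PowA p k n) h).map ι =
        (p : FracW p k) ^ 3 • gram (FracW p k) h := by
      rw [← gram_map ι]
      ext1 a b
      simp only [Matrix.map_apply, Matrix.smul_apply, smul_eq_mul, map_mul, map_pow, map_natCast]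
    rw [← e1, ← hS]
    simp only [Matrix.map_mul, gram_map]
    rfl
  have hS'' := symplectic_transpose (pow_ne_zero 3 hp0) hS'
  -- Substituting $T_0\Phi=D\,\sigma(T_0)$ into $T_0(\Phi g\Phi^\star)T_0^\star$ produces a
  -- Frobenius equation for $T_0gT_0^\star$ alone.
  have key : (p : FracW p k) ^ 3 • (T₀ * gram (FracW p k) h * T₀.transpose) =
      D * (T₀ * gram (FracW p k) h * T₀.transpose).map σ * D := by
    calc (p : FracW p k) ^ 3 • (T₀ * gram (FracW p k) h * T₀.transpose)
        = T₀ * (Φ * gram (FracW p k) h * Φ.transpose) * T₀.transpose := by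
          rw [hS'', Matrix.mul_smul, Matrix.smul_mul]
      _ = (T₀ * Φ) * gram (FracW p k) h * (T₀ * Φ).transpose := by
          rw [Matrix.transpose_mul]
          simp only [mul_assoc]
      _ = D * (T₀ * gram (FracW p k) h * T₀.transpose).map σ * D := by
          rw [hF, Matrix.transpose_mul, hD, Matrix.diagonal_transpose]
          simp only [Matrix.map_mul, gram_map, Matrix.transpose_map, mul_assoc]
  ext1 a b
  by_cases hab : deg a + deg b = 3
  · exact hu.mul_gram_mul_transpose_apply hab
  -- The entry $x$ satisfies $p^3x=p^{\deg a+\deg b}\sigma(x)$ with different exponents, so it is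
  -- $0$ by valuations.
  · rw [gram_eq_zero hab]
    have hk := congrFun (congrFun key a) b
    rw [hD, Matrix.mul_diagonal, Matrix.diagonal_mul, Matrix.smul_apply, Matrix.map_apply,
      smul_eq_mul] at hk
    refine eq_zero_of_pow_mul_frobenius (Ne.symm hab) (hk.trans ?_)
    rw [pow_add]
    ring

/-- In characteristic $0$ a power series is determined by its partial derivatives and its constant
term. The derivative of $TgT^\star$ is $T(\Omega g+g\Omega^\star)T^\star=0$, and the constant term
comes from the slope argument. -/
theorem symplectic (hT : IsAdaptedFrame X Fil U B e T) (hX : IsOrdinaryCY3 X Fil U B h) :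
    T * gram (PowK p k n) h * T.transpose = gram (PowK p k n) h := by
  have := charZero_fracW (p := p) (k := k)
  ext1 a b
  apply MvPowerSeries.pderiv.ext
  · intro j
    have hg : (gram (PowK p k n) h).map (pderiv (FracW p k) j) = 0 := by
      rw [gram_eq_map_C]
      ext1 a b
      simp
    have hΩ := congrArg (fun M : Matrix (Idx h) (Idx h) (PowA p k n) => M.map (toPowK p k n))
      (hT.connMatrix_symplectic' hX j)
    simp only [Matrix.map_add _ (map_add (toPowK p k n)), Matrix.map_mul, gram_map,
      Matrix.transpose_map, Matrix.map_zero _ (map_zero (toPowK p k n))] at hΩ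
    have hmap : (T * gram (PowK p k n) h * T.transpose).map (pderiv (FracW p k) j) = 0 := by
      rw [map_derivation_mul, map_derivation_mul, hg, mul_zero, add_zero, Matrix.transpose_map,
        hT.map_pderiv_eq, Matrix.transpose_mul]
      set Ω := (connMatrix X e j).map (toPowK p k n)
      calc T * Ω * gram (PowK p k n) h * T.transpose +
            T * gram (PowK p k n) h * (Ω.transpose * T.transpose)
          = T * (Ω * gram (PowK p k n) h + gram (PowK p k n) h * Ω.transpose) * T.transpose := by
            simp only [Matrix.mul_add, Matrix.add_mul, mul_assoc]
        _ = 0 := by rw [hΩ, mul_zero, zero_mul]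
    exact (congrFun (congrFun hmap a) b).trans (congrFun (congrFun hg a) b).symm
  · have h0 := congrFun (congrFun (hT.constantCoeff_symplectic hX) a) b
    rw [← gram_map (MvPowerSeries.constantCoeff : PowK p k n →+* FracW p k),
      ← Matrix.transpose_map, ← Matrix.map_mul, ← Matrix.map_mul] at h0
    exact h0

/-! ### The Kodaira–Spencer matrix and its inverse. -/

/-- The matrix of the Kodaira–Spencer map. -/
noncomputable def _root_.CY3Crystal.ksMatrix (X : FCrystal p k n H)
    (e : Module.Basis (Idx h) (PowA p k n) H) : Matrix (Fin h) (Fin n) (PowA p k n) :=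
  Matrix.of fun i j => connMatrix X e j (i2 i) (i3 h)

theorem mem_fil_three_iff (hT : IsAdaptedFrame X Fil U B e T) (hX : IsOrdinaryCY3 X Fil U B h)
    (x : H) : x ∈ Fil 3 ↔ ∀ a, deg a < 3 → e.repr x a = 0 := by
  refine ⟨fun hx a ha => hT.repr_eq_zero_of_mem_fil hX ha le_rfl hx, fun hx => ?_⟩
  rw [← e.sum_repr x]
  refine Submodule.sum_mem _ fun a _ => ?_
  by_cases ha : deg a < 3
  · rw [hx a ha, zero_smul]
    exact Submodule.zero_mem _
  · have : deg a = 3 := le_antisymm (deg_le_three a) (not_lt.mp ha)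
    exact Submodule.smul_mem _ _ (this ▸ hT.basis_mem_fil a)

/-- A vector $v$ is encoded as the map $H^3\to H^2$ with $e_{2h+1}\mapsto\sum_iv_ie_{h+i}$. The
vector fields inducing this map are exactly the solutions $a$ of the linear system with right-hand
side $v$. -/
theorem ksMatrix_mulVec_bijective (hT : IsAdaptedFrame X Fil U B e T)
    (hX : IsOrdinaryCY3 X Fil U B h) (hKS : IsKodairaSpencerIso X Fil U) :
    Function.Bijective (ksMatrix X e).mulVec := by
  rw [Function.bijective_iff_existsUnique]
  intro v
  let v' : hodgePiece U Fil 2 := ∑ i, v i • ⟨e (i2 i), hT.mem (i2 i)⟩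
  have hv' : (v' : H) = ∑ i, v i • e (i2 i) := by simp [v']
  let f : hodgePiece U Fil 3 →ₗ[PowA p k n] hodgePiece U Fil 2 :=
    ((e.coord (i3 h)).comp (hodgePiece U Fil 3).subtype).smulRight v'
  have hf : ∀ x : hodgePiece U Fil 3, (f x : H) = e.repr (x : H) (i3 h) • (v' : H) := fun x => rfl
  have hcoord : ∀ (x : hodgePiece U Fil 3) (a : Fin n → PowA p k n) (c : Idx h), deg c < 3 →
      e.repr ((f x : H) - ∑ j, a j • X.D j (x : H)) c =
        e.repr (x : H) (i3 h) *
          (e.repr (v' : H) c - ∑ j, a j * connMatrix X e j c (i3 h)) := by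
    intro x a c hc
    have hx0 : ∀ d : Idx h, deg d < 3 → e.repr (x : H) d = 0 :=
      (hT.mem_fil_three_iff hX x).mp x.2.2
    have hsum : ∀ j, ∑ b, connMatrix X e j c b * e.repr (x : H) b =
        connMatrix X e j c (i3 h) * e.repr (x : H) (i3 h) := by
      intro j
      refine Finset.sum_eq_single (i3 h) (fun b _ hb => ?_) (by simp)
      rw [hx0 b, mul_zero]
      rcases b with b | b | b | b
      · simp [deg]
      · simp [deg]
      · simp [deg]
      · exact absurd rfl hb
    simp only [hf, map_sub, map_smul, map_sum, Finsupp.coe_sub, Pi.sub_apply, Finsupp.coe_smul,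
      Pi.smul_apply, Finsupp.coe_finsetSum, Finset.sum_apply, smul_eq_mul, repr_D, hx0 c hc,
      map_zero, zero_add, hsum, mul_sub, Finset.mul_sum]
    refine congrArg (HSub.hSub _) (Finset.sum_congr rfl fun j _ => ?_)
    rw [← mul_assoc, mul_comm]
  have hv2 : ∀ i, e.repr (v' : H) (i2 i) = v i := by
    intro i
    rw [hv', map_sum, Finsupp.coe_finsetSum, Finset.sum_apply, Finset.sum_eq_single i]
    · rw [map_smul, e.repr_self, Finsupp.smul_apply, Finsupp.single_eq_same, smul_eq_mul, mul_one]
    · intro j _ hj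
      have : i2 i ≠ i2 j := fun hij =>
        hj (Sum.inl_injective (Sum.inr_injective (Sum.inr_injective hij))).symm
      rw [map_smul, e.repr_self, Finsupp.smul_apply, Finsupp.single_eq_of_ne this, smul_zero]
    · exact fun hi => absurd (Finset.mem_univ i) hi
  have hvz : ∀ c : Idx h, deg c < 2 → e.repr (v' : H) c = 0 := fun c hc =>
    hT.repr_eq_zero_of_mem_fil hX hc (by norm_num) v'.2.2
  have hiff : ∀ a : Fin n → PowA p k n,
      (∀ x : hodgePiece U Fil 3, (f x : H) - ∑ j, a j • X.D j (x : H) ∈ Fil 3) ↔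
        (ksMatrix X e).mulVec a = v := by
    intro a
    have hmv : ∀ i, (ksMatrix X e).mulVec a i = ∑ j, a j * connMatrix X e j (i2 i) (i3 h) :=
      fun i => by
        rw [Matrix.mulVec, dotProduct]
        exact Finset.sum_congr rfl fun j _ => mul_comm _ _
    constructor
    · intro hx
      funext i
      have h1 := hx ⟨e (i3 h), hT.mem (i3 h)⟩
      rw [hT.mem_fil_three_iff hX] at h1
      have h2 := h1 (i2 i) (by simp [deg])
      rw [hcoord _ _ _ (by simp [deg]), hv2, e.repr_self, Finsupp.single_eq_same, one_mul,
        sub_eq_zero] at h2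
      rw [hmv, h2]
    · intro ha x
      rw [hT.mem_fil_three_iff hX]
      intro c hc
      rw [hcoord _ _ _ hc]
      -- In blocks $0$ and $1$ both terms vanish, by $v'\in\mathrm{Fil}^2$ and transversality; the
      -- linear system is the condition in block $2$.
      by_cases hc2 : deg c < 2
      · rw [hvz c hc2, Finset.sum_eq_zero, sub_zero, mul_zero]
        intro j _
        rw [hT.connMatrix_eq_zero hX, mul_zero]
        change deg c + 1 ≠ 3
        omega
      · rcases c with c | c | c | c
        · simp [deg] at hc2
        · simp [deg] at hc2
        · rw [hv2, ← hmv, ha, sub_self, mul_zero]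
        · simp [deg] at hc
  obtain ⟨a, ha, hun⟩ := hKS f
  exact ⟨a, (hiff a).mp ha, fun b hb => hun b ((hiff b).mpr hb)⟩

/-- Bijectivity gives $A^n\simeq A^h$, so the ranks agree and the matrix of the inverse map has
entries in $A$ rather than only in $K[[t]]$. -/
theorem exists_ksMatrix_inverse (hT : IsAdaptedFrame X Fil U B e T)
    (hX : IsOrdinaryCY3 X Fil U B h) (hKS : IsKodairaSpencerIso X Fil U) :
    n = h ∧ ∃ G : Matrix (Fin n) (Fin h) (PowA p k n),
      ksMatrix X e * G = 1 ∧ G * ksMatrix X e = 1 := by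
  let E := LinearEquiv.ofBijective (Matrix.toLin' (ksMatrix X e)) (hT.ksMatrix_mulVec_bijective hX hKS)
  refine ⟨by simpa using E.finrank_eq, LinearMap.toMatrix' E.symm.toLinearMap, ?_, ?_⟩
  · conv_lhs => rw [← LinearMap.toMatrix'_toLin' (ksMatrix X e), ← LinearMap.toMatrix'_comp]
    have : (Matrix.toLin' (ksMatrix X e)).comp E.symm.toLinearMap = LinearMap.id := by
      exact LinearMap.ext fun x => E.apply_symm_apply x
    rw [this, LinearMap.toMatrix'_id]
  · conv_lhs => rw [← LinearMap.toMatrix'_toLin' (ksMatrix X e), ← LinearMap.toMatrix'_comp]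
    have : E.symm.toLinearMap.comp (Matrix.toLin' (ksMatrix X e)) = LinearMap.id := by
      exact LinearMap.ext fun x => E.symm_apply_apply x
    rw [this, LinearMap.toMatrix'_id]

end IsAdaptedFrame
end
-- Factorization of symplectic block unipotent matrices.
/-- A symplectic block unipotent matrix is the product of its two standard factors. -/
theorem IsBlockUnipotent.factorization {R : Type*} [CommRing R] {h : ℕ}
    {T : Matrix (Idx h) (Idx h) R} (hu : IsBlockUnipotent T)
    (hs : T * gram R h * T.transpose = gram R h) :
    (∀ i, T (i0 h) (i1 i) = T (i2 i) (i3 h)) ∧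
    (∀ i j, T (i1 i) (i2 j) = T (i1 j) (i2 i)) ∧
    (∀ i, T (i0 h) (i2 i) =
      ∑ m, T (i2 m) (i3 h) * T (i1 m) (i2 i) - T (i1 i) (i3 h)) ∧
    T = leftFactor (fun i => T (i2 i) (i3 h)) *
      rightFactor (Matrix.of fun i j => T (i1 i) (i2 j)) (fun i => T (i1 i) (i3 h))
        (T (i0 h) (i3 h) - ∑ m, T (i2 m) (i3 h) * T (i1 m) (i3 h)) := by
  have hz : ∀ a b : Idx h, deg b < deg a → T a b = 0 := fun a b => (hu a b).1
  have ho : ∀ a b : Idx h, deg a = deg b → T a b = (1 : Matrix (Idx h) (Idx h) R) a b :=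
    fun a b => (hu a b).2
  have h00 : T (i0 h) (i0 h) = 1 := by rw [ho _ _ rfl, Matrix.one_apply_eq]
  have h33 : T (i3 h) (i3 h) = 1 := by rw [ho _ _ rfl, Matrix.one_apply_eq]
  have h11 : ∀ i j, T (i1 i) (i1 j) = (1 : Matrix (Fin h) (Fin h) R) i j := fun i j => by
    rw [ho (i1 i) (i1 j) rfl, Matrix.one_apply, Matrix.one_apply]
    simp
  have h22 : ∀ i j, T (i2 i) (i2 j) = (1 : Matrix (Fin h) (Fin h) R) i j := fun i j => by
    rw [ho (i2 i) (i2 j) rfl, Matrix.one_apply, Matrix.one_apply]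
    simp
  have h10 : ∀ i, T (i1 i) (i0 h) = 0 := fun i => hz _ _ (by simp [deg])
  have h20 : ∀ i, T (i2 i) (i0 h) = 0 := fun i => hz _ _ (by simp [deg])
  have h21 : ∀ i j, T (i2 i) (i1 j) = 0 := fun i j => hz _ _ (by simp [deg])
  have h30 : T (i3 h) (i0 h) = 0 := hz _ _ (by simp [deg])
  have h31 : ∀ i, T (i3 h) (i1 i) = 0 := fun i => hz _ _ (by simp [deg])
  have h32 : ∀ i, T (i3 h) (i2 i) = 0 := fun i => hz _ _ (by simp [deg])
  have hS : ∀ a b, ∑ d, (∑ c, T a c * gram R h c d) * T b d = gram R h a b := fun a b => by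
    conv_rhs => rw [← hs]
    simp only [Matrix.mul_apply, Matrix.transpose_apply]
  -- The three relations come from blocks $(0,2)$, $(1,1)$ and $(0,1)$ of $TgT^\star=g$. The corner
  -- of the product of the two factors is $Z+\sum_m\tau_m(\tau_{13})_m$, which explains the
  -- correction in the choice of $Z$.
  have e1 : ∀ i, T (i0 h) (i1 i) = T (i2 i) (i3 h) := fun i => by
    have := hS (i0 h) (i2 i)
    simp [Fintype.sum_sum_type, gram, h00, h20, h21, h22, Matrix.one_apply] at this
    linear_combination this
  have e2 : ∀ i j, T (i1 i) (i2 j) = T (i1 j) (i2 i) := fun i j => by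
    have := hS (i1 i) (i1 j)
    simp [Fintype.sum_sum_type, gram, h10, h11, Matrix.one_apply] at this
    linear_combination -this
  have e3 : ∀ i, T (i0 h) (i2 i) =
      ∑ m, T (i2 m) (i3 h) * T (i1 m) (i2 i) - T (i1 i) (i3 h) := fun i => by
    have := hS (i0 h) (i1 i)
    simp [Fintype.sum_sum_type, gram, h00, h10, h11, Matrix.one_apply, e1] at this
    simp only [e2 _ i]
    linear_combination -this
  refine ⟨e1, e2, e3, ?_⟩
  ext1 a b
  rcases a with ⟨⟩ | a | a | ⟨⟩ <;> rcases b with ⟨⟩ | b | b | ⟨⟩ <;>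
    simp [Matrix.mul_apply, Fintype.sum_sum_type, leftFactor, rightFactor, Matrix.one_apply,
      h00, h33, h11, h22, h10, h20, h21, h30, h31, h32, e1, e3]
  ring

/-! ### Differentiation along the coordinates $\tau$ and the Yukawa coupling. -/

section

variable {p : ℕ} [Fact p.Prime] {k : Type*} [Field k] [CharP k p] {n h : ℕ}

/-- `frameDeriv G i` as a derivation. -/
noncomputable def frameDerivation (G : Matrix (Fin n) (Fin h) (PowA p k n)) (i : Fin h) :
    Derivation (FracW p k) (PowK p k n) (PowK p k n) :=
  ∑ j, toPowK p k n (G j i) • pderiv (FracW p k) j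

theorem frameDeriv_eq (G : Matrix (Fin n) (Fin h) (PowA p k n)) (i : Fin h) (f : PowK p k n) :
    frameDeriv G i f = frameDerivation G i f := by
  have := congrFun (map_sum (Derivation.coeFnAddMonoidHom (R := FracW p k) (A := PowK p k n)
    (M := PowK p k n)) (fun j => toPowK p k n (G j i) • pderiv (FracW p k) j) Finset.univ) f
  rw [Finset.sum_apply] at this
  exact this.symm

theorem frameDerivation_apply (G : Matrix (Fin n) (Fin h) (PowA p k n)) (i : Fin h)
    (f : PowK p k n) :
    frameDerivation G i f = ∑ j, toPowK p k n (G j i) * pderiv (FracW p k) j f :=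
  (frameDeriv_eq G i f).symm

end

section

variable {p : ℕ} [Fact p.Prime] {k : Type*} [Field k] [CharP k p] [PerfectRing k p] {n : ℕ}
  {H : Type*} [AddCommGroup H] [Module (PowA p k n) H] {h : ℕ}
  {X : FCrystal p k n H} {Fil U : ℕ → Submodule (PowA p k n) H}
  {B : LinearMap.BilinForm (PowA p k n) H} {e : Module.Basis (Idx h) (PowA p k n) H}
  {T : Matrix (Idx h) (Idx h) (PowK p k n)}

namespace IsAdaptedFrame

theorem pderiv_apply (hT : IsAdaptedFrame X Fil U B e T) (j : Fin n) (a b : Idx h) :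
    pderiv (FracW p k) j (T a b) = ∑ c, T a c * toPowK p k n (connMatrix X e j c b) :=
  congrFun (congrFun (hT.map_pderiv_eq j) a) b

/-- The last column of $\Omega$ is concentrated in block $2$, where $T$ has an identity block. Thus
the Jacobian of $\tau_{23}$ is the Kodaira–Spencer matrix. -/
theorem pderiv_i2_i3 (hT : IsAdaptedFrame X Fil U B e T) (hX : IsOrdinaryCY3 X Fil U B h)
    (j : Fin n) (i : Fin h) :
    pderiv (FracW p k) j (T (i2 i) (i3 h)) = toPowK p k n (ksMatrix X e i j) := by
  rw [hT.pderiv_apply, Finset.sum_eq_single (i2 i)]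
  · rw [(hT.unipotent _ _).2 rfl, Matrix.one_apply_eq, one_mul]
    rfl
  · intro c _ hc
    by_cases h2 : deg c = 2
    · rw [(hT.unipotent _ _).2 (show deg (i2 i) = deg c from h2.symm),
        Matrix.one_apply_ne hc.symm, zero_mul]
    · rw [hT.connMatrix_eq_zero hX j (show deg c + 1 ≠ 3 by omega), map_zero, mul_zero]
  · exact fun hc => absurd (Finset.mem_univ _) hc

theorem pderiv_i1_i2 (hT : IsAdaptedFrame X Fil U B e T) (hX : IsOrdinaryCY3 X Fil U B h)
    (j : Fin n) (i l : Fin h) :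
    pderiv (FracW p k) j (T (i1 i) (i2 l)) = toPowK p k n (connMatrix X e j (i1 i) (i2 l)) := by
  rw [hT.pderiv_apply, Finset.sum_eq_single (i1 i)]
  · rw [(hT.unipotent _ _).2 rfl, Matrix.one_apply_eq, one_mul]
  · intro c _ hc
    by_cases h2 : deg c = 1
    · rw [(hT.unipotent _ _).2 (show deg (i1 i) = deg c from h2.symm),
        Matrix.one_apply_ne hc.symm, zero_mul]
    · rw [hT.connMatrix_eq_zero hX j (show deg c + 1 ≠ 2 by omega), map_zero, mul_zero]
  · exact fun hc => absurd (Finset.mem_univ _) hc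

theorem pderiv_i3 (hT : IsAdaptedFrame X Fil U B e T) (hX : IsOrdinaryCY3 X Fil U B h)
    (j : Fin n) (a : Idx h) :
    pderiv (FracW p k) j (T a (i3 h)) =
      ∑ m, T a (i2 m) * pderiv (FracW p k) j (T (i2 m) (i3 h)) := by
  simp only [hT.pderiv_i2_i3 hX]
  rw [hT.pderiv_apply]
  have h0 := hT.connMatrix_eq_zero hX j (a := i0 h) (b := i3 h) (by simp [deg])
  have h1 := fun m => hT.connMatrix_eq_zero hX j (a := i1 m) (b := i3 h) (by simp [deg])
  have h3 := hT.connMatrix_eq_zero hX j (a := i3 h) (b := i3 h) (by simp [deg])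
  simp [Fintype.sum_sum_type, h0, h1, h3, ksMatrix]

/-- `∇` of the middle part of the frame is, up to duality, the Kodaira–Spencer map. -/
theorem connMatrix_i0_i1 (hT : IsAdaptedFrame X Fil U B e T) (hX : IsOrdinaryCY3 X Fil U B h)
    (j : Fin n) (m : Fin h) : connMatrix X e j (i0 h) (i1 m) = ksMatrix X e m j := by
  have := congrFun (congrFun (hT.connMatrix_symplectic' hX j) (i0 h)) (i2 m)
  simp [Matrix.mul_apply, Fintype.sum_sum_type, gram, Matrix.one_apply] at this
  rw [add_neg_eq_zero] at this
  exact this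

variable {G : Matrix (Fin n) (Fin h) (PowA p k n)}

omit [CharP k p] [PerfectRing k p] in
theorem sum_mul_ksMatrix (hG : ksMatrix X e * G = 1) (i m : Fin h) :
    ∑ j, G j i * ksMatrix X e m j = (1 : Matrix (Fin h) (Fin h) (PowA p k n)) m i := by
  rw [← hG, Matrix.mul_apply]
  exact Finset.sum_congr rfl fun j _ => mul_comm _ _

/-- $G$ inverts the Kodaira–Spencer matrix, and $\nabla e_{2h+1}$ has components in block $2$ only,
so the equality is exact and not merely modulo $\mathrm{Fil}^3$. -/
theorem frameNabla_i3 (hT : IsAdaptedFrame X Fil U B e T) (hX : IsOrdinaryCY3 X Fil U B h)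
    (hG : ksMatrix X e * G = 1) (l : Fin h) :
    frameNabla X G l (e (i3 h)) = e (i2 l) := by
  apply e.repr.injective
  ext1 a
  have hD : ∀ j, e.repr (X.D j (e (i3 h))) a = connMatrix X e j a (i3 h) := fun j => rfl
  simp only [frameNabla, map_sum, map_smul, Finsupp.coe_finsetSum, Finset.sum_apply,
    Finsupp.coe_smul, Pi.smul_apply, smul_eq_mul, hD, e.repr_self]
  by_cases h2 : deg a = 2
  · rcases a with a | a | a | a
    · simp [deg] at h2
    · simp [deg] at h2
    · refine (sum_mul_ksMatrix hG l a).trans ?_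
      rw [Matrix.one_apply, Finsupp.single_apply]
      simp [eq_comm]
    · simp [deg] at h2
  · rw [Finset.sum_eq_zero, Finsupp.single_eq_of_ne]
    · rintro rfl
      exact h2 rfl
    · intro j _
      rw [hT.connMatrix_eq_zero hX j (show deg a + 1 ≠ 3 by omega), mul_zero]

omit [CharP k p] [PerfectRing k p] in
theorem repr_frameNabla_i2 (j l : Fin h) (a : Idx h) :
    e.repr (frameNabla X G j (e (i2 l))) a = ∑ r, G r j * connMatrix X e r a (i2 l) := by
  have hD : ∀ r, e.repr (X.D r (e (i2 l))) a = connMatrix X e r a (i2 l) := fun r => rfl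
  simp only [frameNabla, map_sum, map_smul, Finsupp.coe_finsetSum, Finset.sum_apply,
    Finsupp.coe_smul, Pi.smul_apply, smul_eq_mul, hD]

/-- The Yukawa coupling in terms of the connection matrix. -/
theorem yukawa_eq (hT : IsAdaptedFrame X Fil U B e T) (hX : IsOrdinaryCY3 X Fil U B h)
    (hG : ksMatrix X e * G = 1) (i j l : Fin h) :
    B (e (i3 h)) (frameNabla X G i (frameNabla X G j (frameNabla X G l (e (i3 h))))) =
      ∑ r, G r j * connMatrix X e r (i1 i) (i2 l) := by
  rw [hT.frameNabla_i3 hX hG, hT.form_basis_left]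
  set y := frameNabla X G j (e (i2 l)) with hy
  have hy1 : ∀ a : Idx h, deg a ≠ 1 → e.repr y a = 0 := by
    intro a ha
    rw [hy, repr_frameNabla_i2]
    refine Finset.sum_eq_zero fun r _ => ?_
    rw [hT.connMatrix_eq_zero hX r (show deg a + 1 ≠ 2 by omega), mul_zero]
  -- Pairing with $e_{2h+1}$ reads off the $e_0$-coordinate. As $y$ lies in block $1$, this
  -- coordinate comes only from the $(0,1)$ block of $\Omega$, which $G$ inverts.
  have hgr : ∑ b, gram (PowA p k n) h (i3 h) b * e.repr (frameNabla X G i y) b =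
      e.repr (frameNabla X G i y) (i0 h) := by
    simp [Fintype.sum_sum_type, gram]
  have hsum : ∀ r, ∑ b, connMatrix X e r (i0 h) b * e.repr y b =
      ∑ m, ksMatrix X e m r * e.repr y (i1 m) := by
    intro r
    have h0 := hy1 (i0 h) (by simp [deg])
    have h2 := fun m => hy1 (i2 m) (by simp [deg])
    have h3 := hy1 (i3 h) (by simp [deg])
    simp [Fintype.sum_sum_type, h0, h2, h3, hT.connMatrix_i0_i1 hX]
  rw [hgr, repr_frameNabla, ← repr_frameNabla_i2, ← hy]
  simp only [hy1 (i0 h) (by simp [deg]), map_zero, zero_add, hsum, Finset.mul_sum]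
  rw [Finset.sum_comm]
  simp only [← mul_assoc, ← Finset.sum_mul, sum_mul_ksMatrix hG]
  simp [Matrix.one_apply]

theorem frameDerivation_i2_i3 (hT : IsAdaptedFrame X Fil U B e T) (hX : IsOrdinaryCY3 X Fil U B h)
    (hG : ksMatrix X e * G = 1) (i m : Fin h) :
    frameDerivation G i (T (i2 m) (i3 h)) = (1 : Matrix (Fin h) (Fin h) (PowK p k n)) m i := by
  have := congrArg (toPowK p k n) (sum_mul_ksMatrix hG i m)
  simp only [map_sum, map_mul] at this
  simp only [frameDerivation_apply, hT.pderiv_i2_i3 hX, this, Matrix.one_apply]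
  split_ifs <;> simp

/-- This is $dT_{a,2h+1}=\sum_mT_{a,h+m}\,d\tau_m$ contracted with $\partial/\partial\tau_i$. It is
used for $a$ in block $1$, where it differentiates $\tau_{13}$, and for $a=0$, where it
differentiates the corner entry. -/
theorem frameDerivation_i3 (hT : IsAdaptedFrame X Fil U B e T) (hX : IsOrdinaryCY3 X Fil U B h)
    (hG : ksMatrix X e * G = 1) (i : Fin h) (a : Idx h) :
    frameDerivation G i (T a (i3 h)) = T a (i2 i) := by
  have h1 : frameDerivation G i (T a (i3 h)) =
      ∑ m, T a (i2 m) * frameDerivation G i (T (i2 m) (i3 h)) := by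
    simp only [frameDerivation_apply, hT.pderiv_i3 hX _ a, Finset.mul_sum]
    rw [Finset.sum_comm]
    exact Finset.sum_congr rfl fun m _ => Finset.sum_congr rfl fun j _ => mul_left_comm _ _ _
  simp [h1, hT.frameDerivation_i2_i3 hX hG, Matrix.one_apply]

/-- Applying $d$ to $d(\tau_{13})_l=\sum_m(\tau_{12})_{lm}\,d\tau_m$ gives
$\sum_md(\tau_{12})_{lm}\wedge d\tau_m=0$, to be contracted with $\partial/\partial\tau_i$ and
$\partial/\partial\tau_j$. Only the commutation of the $\partial/\partial t_j$ is needed. -/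
theorem frameDerivation_i1_i2_comm (hT : IsAdaptedFrame X Fil U B e T)
    (hX : IsOrdinaryCY3 X Fil U B h) (hG : ksMatrix X e * G = 1) (i j l : Fin h) :
    frameDerivation G i (T (i1 l) (i2 j)) = frameDerivation G j (T (i1 l) (i2 i)) := by
  have hsymm : ∀ a b : Fin n,
      ∑ m, pderiv (FracW p k) a (T (i1 l) (i2 m)) * pderiv (FracW p k) b (T (i2 m) (i3 h)) =
      ∑ m, pderiv (FracW p k) b (T (i1 l) (i2 m)) * pderiv (FracW p k) a (T (i2 m) (i3 h)) := by
    intro a b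
    have h1 := pderiv_comm (R := FracW p k) a b (T (i1 l) (i3 h))
    rw [hT.pderiv_i3 hX b, hT.pderiv_i3 hX a] at h1
    simp only [map_sum, Derivation.leibniz, smul_eq_mul, Finset.sum_add_distrib] at h1
    simp only [pderiv_comm a b (T (i2 _) (i3 h))] at h1
    have h2 := add_left_cancel h1
    simpa only [mul_comm] using h2
  have hexp : ∀ i j : Fin h, frameDerivation G i (T (i1 l) (i2 j)) =
      ∑ a, ∑ b, toPowK p k n (G a i) * toPowK p k n (G b j) *
        ∑ m, pderiv (FracW p k) a (T (i1 l) (i2 m)) * pderiv (FracW p k) b (T (i2 m) (i3 h)) := by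
    intro i j
    have h1 : ∀ a, ∑ b, toPowK p k n (G a i) * toPowK p k n (G b j) *
        ∑ m, pderiv (FracW p k) a (T (i1 l) (i2 m)) * pderiv (FracW p k) b (T (i2 m) (i3 h)) =
        toPowK p k n (G a i) * ∑ m, pderiv (FracW p k) a (T (i1 l) (i2 m)) *
          frameDerivation G j (T (i2 m) (i3 h)) := by
      intro a
      simp only [frameDerivation_apply, Finset.mul_sum]
      rw [Finset.sum_comm]
      exact Finset.sum_congr rfl fun m _ => Finset.sum_congr rfl fun b _ => by ring
    simp only [h1, hT.frameDerivation_i2_i3 hX hG]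
    rw [frameDerivation_apply]
    simp [Matrix.one_apply]
  rw [hexp, hexp, Finset.sum_comm]
  refine Finset.sum_congr rfl fun a _ => Finset.sum_congr rfl fun b _ => ?_
  rw [hsymm, mul_comm (toPowK p k n (G b i))]

/-- The second derivatives of the prepotential. -/
theorem frameDerivation_prepotential (hT : IsAdaptedFrame X Fil U B e T)
    (hX : IsOrdinaryCY3 X Fil U B h) (hG : ksMatrix X e * G = 1) (l : Fin h) :
    frameDerivation G l (T (i0 h) (i3 h) - ∑ m, T (i2 m) (i3 h) * T (i1 m) (i3 h)) =
      -(T (i1 l) (i3 h) + T (i1 l) (i3 h)) := by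
  obtain ⟨-, -, hb, -⟩ := hT.unipotent.factorization (hT.symplectic hX)
  simp only [map_sub, map_sum, Derivation.leibniz, smul_eq_mul, hT.frameDerivation_i2_i3 hX hG]
  -- One $-(\tau_{13})_l$ comes from $T_{0,h+l}$ through the symplectic relation, the other from the
  -- product rule; the $\tau_{12}$ terms cancel.
  rw [hT.frameDerivation_i3 hX hG, hb]
  simp only [hT.frameDerivation_i3 hX hG, Finset.sum_add_distrib]
  simp [Matrix.one_apply]
  ring

end IsAdaptedFrame

end

end CY3Crystal

theorem corollary2p3 {p : ℕ} [Fact p.Prime] (hp : 3 < p)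
    {k : Type*} [Field k] [CharP k p] [IsAlgClosed k] {n h : ℕ}
    {H : Type*} [AddCommGroup H] [Module (CY3Crystal.PowA p k n) H]
    (X : CY3Crystal.FCrystal p k n H)
    (Fil U : ℕ → Submodule (CY3Crystal.PowA p k n) H)
    (B : LinearMap.BilinForm (CY3Crystal.PowA p k n) H)
    (hX : CY3Crystal.IsOrdinaryCY3 X Fil U B h)
    (hKS : CY3Crystal.IsKodairaSpencerIso X Fil U)
    (e : Module.Basis (CY3Crystal.Idx h) (CY3Crystal.PowA p k n) H)
    (T : Matrix (CY3Crystal.Idx h) (CY3Crystal.Idx h) (CY3Crystal.PowK p k n))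
    (hT : CY3Crystal.IsAdaptedFrame X Fil U B e T) :
    ∃ (τ₂₃ τ₁₃ : Fin h → CY3Crystal.PowK p k n)
      (τ₁₂ : Matrix (Fin h) (Fin h) (CY3Crystal.PowK p k n)) (Z : CY3Crystal.PowK p k n),
      T = CY3Crystal.leftFactor τ₂₃ * CY3Crystal.rightFactor τ₁₂ τ₁₃ Z ∧
      n = h ∧
      ∃ G : Matrix (Fin n) (Fin h) (CY3Crystal.PowA p k n),
        CY3Crystal.jacobian τ₂₃ * G.map (CY3Crystal.toPowK p k n) = 1 ∧
        G.map (CY3Crystal.toPowK p k n) * CY3Crystal.jacobian τ₂₃ = 1 ∧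
        ∀ i j l : Fin h,
          CY3Crystal.toPowK p k n
            (B (e (CY3Crystal.i3 h))
              (CY3Crystal.frameNabla X G i
                (CY3Crystal.frameNabla X G j
                  (CY3Crystal.frameNabla X G l (e (CY3Crystal.i3 h)))))) =
          (-(1 / 2) : CY3Crystal.FracW p k) •
            CY3Crystal.frameDeriv G i
              (CY3Crystal.frameDeriv G j (CY3Crystal.frameDeriv G l Z)) := by
  obtain ⟨hnh, G, hG, hG'⟩ := hT.exists_ksMatrix_inverse hX hKS
  obtain ⟨-, hsymm, -, hfac⟩ := hT.unipotent.factorization (hT.symplectic hX)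
  have hJ : CY3Crystal.jacobian (fun i => T (CY3Crystal.i2 i) (CY3Crystal.i3 h)) =
      (CY3Crystal.ksMatrix X e).map (CY3Crystal.toPowK p k n) := by
    ext1 i j
    exact hT.pderiv_i2_i3 hX j i
  refine ⟨_, _, _, _, hfac, hnh, G, ?_, ?_, fun i j l => ?_⟩
  · rw [hJ, ← Matrix.map_mul, hG, Matrix.map_one _ (map_zero _) (map_one _)]
  · rw [hJ, ← Matrix.map_mul, hG', Matrix.map_one _ (map_zero _) (map_one _)]
  · have := CY3Crystal.charZero_fracW (p := p) (k := k)
    have hlhs : CY3Crystal.toPowK p k n (∑ r, G r j *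
        CY3Crystal.connMatrix X e r (CY3Crystal.i1 i) (CY3Crystal.i2 l)) =
        CY3Crystal.frameDerivation G j (T (CY3Crystal.i1 i) (CY3Crystal.i2 l)) := by
      simp only [CY3Crystal.frameDerivation_apply, hT.pderiv_i1_i2 hX, map_sum, map_mul]
    -- The right side reduces to $\partial_i(\tau_{12})_{lj}$. The left side
    -- $\partial_j(\tau_{12})_{il}$ becomes this by symmetry of $\tau_{12}$ followed by the exchange
    -- of $i$ and $j$.
    rw [hT.yukawa_eq hX hG, hlhs, CY3Crystal.frameDeriv_eq, CY3Crystal.frameDeriv_eq,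
      CY3Crystal.frameDeriv_eq, hT.frameDerivation_prepotential hX hG, map_neg, map_add, map_neg,
      map_add, hT.frameDerivation_i3 hX hG, hsymm i l,
      hT.frameDerivation_i1_i2_comm hX hG, ← two_smul (CY3Crystal.FracW p k), smul_neg,
      neg_smul, neg_neg, smul_smul]
    norm_num
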